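/- Let $n\ge 1$ be an integer, let $\alpha\ge 1$ be real, and let $X_1,\dots,X_n$ be independent random variables, each having the gamma distribution with shape $\alpha$ and scale $1$. For a real vector $w=(w_1,\dots,w_n)$ let $F_w(x)=\Pr\left(\sum_{i=1}^n w_iX_i\le x\right)$ be the distribution function of the weighted sum. Let $\theta,\eta\in\mathbb{R}^n$ satisfy $0<\theta_1\le\cdots\le\theta_n$ and $\eta_1\le\cdots\le\eta_n$, and suppose that (a) there is an integer $k$ with $2\le k\le n$ such that $\theta_i<\eta_i$ for all $i<k$ and $\theta_i>\eta_i$ for all $i\ge k$; (b) $\prod_{i=1}^n\eta_i>\prod_{i=1}^n\theta_i$. Then there exists $x_0\in(0,\infty)$ such that $F_\eta(x)<F_\theta(x)$ for all $x\in(0,x_0)$ and $F_\eta(x)>F_\theta(x)$ for all $x>x_0$. -/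

import Mathlib

open MeasureTheory ProbabilityTheory

/-- The distribution function `x ↦ P(∑ i, θ i * X i ≤ x)` of the weighted sum, with weight
vector `θ`, of the random variables `X i`. -/
noncomputable def weightedSumCDF {Ω : Type*} [MeasurableSpace Ω] (P : Measure Ω) {n : ℕ}
    (X : Fin n → Ω → ℝ) (θ : Fin n → ℝ) (x : ℝ) : ℝ :=
  cdf (P.map (fun ω => ∑ i, θ i * X i ω)) x

/-!
Write `F w` for the distribution function of `∑ i, w i * X i`. The unique crossing follows from a
pointwise statement, `IsGammaFamily.weightedSumCDF_lt_of_eq`: if `F θ` and `F η` agree at some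
`x > 0`, then `F θ y < F η y` for every `y > x`. Hence there is at most one crossing, from below to
above. There is one because `F η` is smaller than `F θ` near the origin, where `F w x` behaves like
a constant times `x ^ (n * α) / (∏ i, w i) ^ α`, and larger near infinity, where the tail is
governed by the largest weight.

The pointwise statement comes from an optimization. Among the weight vectors `w` between `θ` and `η`
with `F w x = F η x`, a compact set, take one which maximizes `F w y`. As `F` is strictly
decreasing in each weight, if `w ≠ η` then there are indices `i`, `j` with
`w i < η i ≤ η j < w j`. Raising `w i` and lowering `w j` slightly, so that `F w x` does not change,
increases `F w y` (`IsGammaFamily.exists_transfer`) and stays between `θ` and `η`, which contradicts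
maximality.

That a transfer from the larger to the smaller weight has this effect is seen infinitesimally. The
derivative of `F w x` in `w i` is `-α` times the density at `x` of `∑ l, w l * X l + w i * E`, with
`E` an independent standard exponential variable. So the claim is that the quotient of these
densities for `j` and for `i` is strictly increasing in `x`: the likelihood ratio ordering of
`w i * E` and `w j * E` has to survive the addition of `∑ l, w l * X l`. It does because the density
of this sum is log-concave, that is, a Pólya frequency function of order two; here the shape
`α ≥ 1` is used. Both the closure of such functions under convolution and the preservation of
the likelihood ratio order (`IsPolyaKernel.exponential_ratio_lt`) are instances of the Andréief
identity for `2 × 2` determinants, `integral_minor_mul_minor`.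
-/

open Set Filter Topology

/-! ### The Andréief identity and Pólya frequency kernels -/

/-- The Andréief (continuous Cauchy–Binet) identity for `2 × 2` determinants. -/
theorem integral_minor_mul_minor {μ : Measure ℝ} [SFinite μ] {A₁ A₂ B₁ B₂ : ℝ → ℝ}
    (h₁₁ : Integrable (fun z => A₁ z * B₁ z) μ) (h₁₂ : Integrable (fun z => A₁ z * B₂ z) μ)
    (h₂₁ : Integrable (fun z => A₂ z * B₁ z) μ) (h₂₂ : Integrable (fun z => A₂ z * B₂ z) μ) :
    Integrable (fun p : ℝ × ℝ => (A₁ p.1 * A₂ p.2 - A₁ p.2 * A₂ p.1) *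
      (B₁ p.1 * B₂ p.2 - B₁ p.2 * B₂ p.1)) (μ.prod μ) ∧
    ∫ p : ℝ × ℝ, (A₁ p.1 * A₂ p.2 - A₁ p.2 * A₂ p.1) *
      (B₁ p.1 * B₂ p.2 - B₁ p.2 * B₂ p.1) ∂(μ.prod μ) =
    2 * ((∫ z, A₁ z * B₁ z ∂μ) * (∫ z, A₂ z * B₂ z ∂μ) -
      (∫ z, A₁ z * B₂ z ∂μ) * (∫ z, A₂ z * B₁ z ∂μ)) := by
  have i1 := h₁₁.mul_prod h₂₂
  have i2 := h₁₂.mul_prod h₂₁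
  have i3 := h₂₁.mul_prod h₁₂
  have i4 := h₂₂.mul_prod h₁₁
  have e : (fun p : ℝ × ℝ => (A₁ p.1 * A₂ p.2 - A₁ p.2 * A₂ p.1) *
      (B₁ p.1 * B₂ p.2 - B₁ p.2 * B₂ p.1)) = fun p : ℝ × ℝ =>
      ((A₁ p.1 * B₁ p.1) * (A₂ p.2 * B₂ p.2) - (A₁ p.1 * B₂ p.1) * (A₂ p.2 * B₁ p.2)
      - (A₂ p.1 * B₁ p.1) * (A₁ p.2 * B₂ p.2)) + (A₂ p.1 * B₂ p.1) * (A₁ p.2 * B₁ p.2) := by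
    ext p; ring
  rw [e]
  refine ⟨((i1.sub i2).sub i3).add i4, ?_⟩
  rw [integral_add (by exact (i1.sub i2).sub i3) i4, integral_sub (by exact i1.sub i2) i3,
    integral_sub i1 i2]
  rw [integral_prod_mul (fun z => A₁ z * B₁ z) (fun z => A₂ z * B₂ z),
    integral_prod_mul (fun z => A₁ z * B₂ z) (fun z => A₂ z * B₁ z),
    integral_prod_mul (fun z => A₂ z * B₁ z) (fun z => A₁ z * B₂ z),
    integral_prod_mul (fun z => A₂ z * B₂ z) (fun z => A₁ z * B₁ z)]
  ring

/-- If the minors are nonnegative for `z ≤ w`, their product is nonnegative everywhere, since both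
minors are antisymmetric in `(z, w)`. -/
theorem minor_mul_minor_nonneg {A₁ A₂ B₁ B₂ : ℝ → ℝ}
    (hA : ∀ z w, z ≤ w → A₁ w * A₂ z ≤ A₁ z * A₂ w)
    (hB : ∀ z w, z ≤ w → B₁ w * B₂ z ≤ B₁ z * B₂ w) (p : ℝ × ℝ) :
    0 ≤ (A₁ p.1 * A₂ p.2 - A₁ p.2 * A₂ p.1) * (B₁ p.1 * B₂ p.2 - B₁ p.2 * B₂ p.1) := by
  rcases le_total p.1 p.2 with h | h
  · exact mul_nonneg (sub_nonneg.2 (hA _ _ h)) (sub_nonneg.2 (hB _ _ h))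
  · have h1 := hA _ _ h
    have h2 := hB _ _ h
    exact mul_nonneg_of_nonpos_of_nonpos (by linarith) (by linarith)

theorem integral_mul_integral_le_of_minors {μ : Measure ℝ} [SFinite μ] {A₁ A₂ B₁ B₂ : ℝ → ℝ}
    (h₁₁ : Integrable (fun z => A₁ z * B₁ z) μ) (h₁₂ : Integrable (fun z => A₁ z * B₂ z) μ)
    (h₂₁ : Integrable (fun z => A₂ z * B₁ z) μ) (h₂₂ : Integrable (fun z => A₂ z * B₂ z) μ)
    (hA : ∀ z w, z ≤ w → A₁ w * A₂ z ≤ A₁ z * A₂ w)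
    (hB : ∀ z w, z ≤ w → B₁ w * B₂ z ≤ B₁ z * B₂ w) :
    (∫ z, A₁ z * B₂ z ∂μ) * (∫ z, A₂ z * B₁ z ∂μ) ≤
      (∫ z, A₁ z * B₁ z ∂μ) * (∫ z, A₂ z * B₂ z ∂μ) := by
  have h := (integral_minor_mul_minor h₁₁ h₁₂ h₂₁ h₂₂).2
  have : (0 : ℝ) ≤ 2 * ((∫ z, A₁ z * B₁ z ∂μ) * (∫ z, A₂ z * B₂ z ∂μ) -
      (∫ z, A₁ z * B₂ z ∂μ) * (∫ z, A₂ z * B₁ z ∂μ)) := by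
    rw [← h]
    exact integral_nonneg (minor_mul_minor_nonneg hA hB)
  linarith

theorem integral_mul_integral_lt_of_minors {μ : Measure ℝ} [SFinite μ] {A₁ A₂ B₁ B₂ : ℝ → ℝ}
    (h₁₁ : Integrable (fun z => A₁ z * B₁ z) μ) (h₁₂ : Integrable (fun z => A₁ z * B₂ z) μ)
    (h₂₁ : Integrable (fun z => A₂ z * B₁ z) μ) (h₂₂ : Integrable (fun z => A₂ z * B₂ z) μ)
    (hA : ∀ z w, z ≤ w → A₁ w * A₂ z ≤ A₁ z * A₂ w)
    (hB : ∀ z w, z ≤ w → B₁ w * B₂ z ≤ B₁ z * B₂ w)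
    {s t : Set ℝ} (hs : μ s ≠ 0) (ht : μ t ≠ 0)
    (hst : ∀ z ∈ s, ∀ w ∈ t, A₁ w * A₂ z < A₁ z * A₂ w ∧ B₁ w * B₂ z < B₁ z * B₂ w) :
    (∫ z, A₁ z * B₂ z ∂μ) * (∫ z, A₂ z * B₁ z ∂μ) <
      (∫ z, A₁ z * B₁ z ∂μ) * (∫ z, A₂ z * B₂ z ∂μ) := by
  obtain ⟨hi, h⟩ := integral_minor_mul_minor h₁₁ h₁₂ h₂₁ h₂₂
  have : 0 < ∫ p : ℝ × ℝ, (A₁ p.1 * A₂ p.2 - A₁ p.2 * A₂ p.1) *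
      (B₁ p.1 * B₂ p.2 - B₁ p.2 * B₂ p.1) ∂(μ.prod μ) := by
    rw [integral_pos_iff_support_of_nonneg (minor_mul_minor_nonneg hA hB) hi]
    have hsub : s ×ˢ t ⊆ Function.support fun p : ℝ × ℝ => (A₁ p.1 * A₂ p.2 - A₁ p.2 * A₂ p.1) *
        (B₁ p.1 * B₂ p.2 - B₁ p.2 * B₂ p.1) := by
      rintro ⟨z, w⟩ ⟨hz, hw⟩
      obtain ⟨h1, h2⟩ := hst z hz w hw
      exact (mul_pos (sub_pos.2 h1) (sub_pos.2 h2)).ne'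
    refine lt_of_lt_of_le ?_ (measure_mono hsub)
    rw [Measure.prod_prod]
    exact pos_iff_ne_zero.2 (mul_ne_zero hs ht)
  linarith

/-- A kernel on the half-line: a bounded measurable function which vanishes on `(-∞, 0)`, is
positive on `(0, ∞)` and is a Pólya frequency function of order two (equivalently, log-concave).
The last property is stated without logarithms, as `h u * h (u + p + q) ≤ h (u + p) * h (u + q)`. -/
structure IsPolyaKernel (h : ℝ → ℝ) : Prop where
  measurable : Measurable h
  bounded : ∃ C, ∀ x, h x ≤ C
  nonneg : ∀ x, 0 ≤ h x
  eq_zero : ∀ x < 0, h x = 0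
  pos : ∀ x, 0 < x → 0 < h x
  mul_le : ∀ u p q, 0 ≤ p → 0 ≤ q → h u * h (u + p + q) ≤ h (u + p) * h (u + q)

namespace IsPolyaKernel

variable {h : ℝ → ℝ}

theorem exists_abs_le (hh : IsPolyaKernel h) : ∃ C, 0 ≤ C ∧ ∀ x, |h x| ≤ C := by
  obtain ⟨C, hC⟩ := hh.bounded
  refine ⟨C, (hh.nonneg 0).trans (hC 0), fun x => ?_⟩
  rw [abs_of_nonneg (hh.nonneg x)]
  exact hC x

/-- The translates of a Pólya frequency function form a totally positive family. -/
theorem translate_mul_le (hh : IsPolyaKernel h) {x y z w : ℝ} (hxy : x ≤ y) (hzw : z ≤ w) :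
    h (x - w) * h (y - z) ≤ h (x - z) * h (y - w) := by
  have := hh.mul_le (x - w) (w - z) (y - x) (by linarith) (by linarith)
  convert this using 3 <;> ring

theorem integrable_mul (hh : IsPolyaKernel h) {Ω : Type*} [MeasurableSpace Ω] {μ : Measure Ω}
    {T g : Ω → ℝ} (hT : Measurable T) (hg : Integrable g μ) :
    Integrable (fun ω => h (T ω) * g ω) μ := by
  obtain ⟨C, hC0, hC⟩ := hh.exists_abs_le
  exact hg.bdd_mul (c := C) ((hh.measurable.comp hT).aestronglyMeasurable)
    (ae_of_all _ fun ω => by simpa using hC (T ω))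

theorem integrable_comp (hh : IsPolyaKernel h) {Ω : Type*} [MeasurableSpace Ω] {μ : Measure Ω}
    [IsFiniteMeasure μ] {T : Ω → ℝ} (hT : Measurable T) : Integrable (fun ω => h (T ω)) μ := by
  simpa using hh.integrable_mul hT (integrable_const (1 : ℝ) (μ := μ))

theorem comp_div (hh : IsPolyaKernel h) {a : ℝ} (ha : 0 < a) :
    IsPolyaKernel fun x => h (x / a) where
  measurable := hh.measurable.comp (measurable_id.div_const a)
  bounded := hh.bounded.imp fun C hC x => hC _
  nonneg x := hh.nonneg _
  eq_zero x hx := hh.eq_zero _ (div_neg_of_neg_of_pos hx ha)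
  pos x hx := hh.pos _ (div_pos hx ha)
  mul_le u p q hp hq := by
    simp only [add_div]
    exact hh.mul_le _ _ _ (by positivity) (by positivity)

/-- Pólya kernels are stable under convolution with an integrable Pólya kernel. -/
theorem convolution (hh : IsPolyaKernel h) {k : ℝ → ℝ} (hk : IsPolyaKernel k)
    (hki : Integrable k) {a : ℝ} (ha : 0 < a) :
    IsPolyaKernel fun x => ∫ t, h (x - a * t) * k t where
  measurable := by
    have : StronglyMeasurable (Function.uncurry fun x t : ℝ => h (x - a * t) * k t) :=
      ((hh.measurable.comp (measurable_fst.sub (measurable_snd.const_mul a))).mul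
        (hk.measurable.comp measurable_snd)).stronglyMeasurable
    exact this.integral_prod_right.measurable
  bounded := by
    obtain ⟨C, hC⟩ := hh.bounded
    refine ⟨∫ t, C * k t, fun x => integral_mono (hh.integrable_mul (by fun_prop) hki)
      (hki.const_mul C) fun t => mul_le_mul_of_nonneg_right (hC _) (hk.nonneg t)⟩
  nonneg x := integral_nonneg fun t => mul_nonneg (hh.nonneg _) (hk.nonneg _)
  eq_zero x hx := by
    refine integral_eq_zero_of_ae (ae_of_all _ fun t => ?_)
    rcases lt_or_ge t 0 with ht | ht
    · simp [hk.eq_zero t ht]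
    · simp [hh.eq_zero (x - a * t) (by nlinarith [mul_nonneg ha.le ht])]
  pos x hx := by
    rw [integral_pos_iff_support_of_nonneg (fun t => mul_nonneg (hh.nonneg _) (hk.nonneg _))
      (hh.integrable_mul (by fun_prop) hki)]
    refine lt_of_lt_of_le ?_ (measure_mono (s := Ioo 0 (x / a)) fun t ht => ?_)
    · simpa using div_pos hx ha
    · have : a * t < x := by have := (lt_div_iff₀ ha).1 ht.2; linarith
      exact (mul_pos (hh.pos _ (by linarith)) (hk.pos _ ht.1)).ne'
  mul_le u p q hp hq := by
    have shift : ∀ X S : ℝ, ∫ t, h (X - a * t) * k (t - S) = ∫ t, h (X - a * S - a * t) * k t := by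
      intro X S
      rw [← integral_add_right_eq_self _ S]
      congr 1; ext t; congr 2 <;> ring
    have hint : ∀ X S : ℝ, Integrable fun t => h (X - a * t) * k (t - S) := fun X S =>
      hh.integrable_mul (by fun_prop) (hki.comp_sub_right S)
    have hqa : a * (q / a) = q := by field_simp
    have key := integral_mul_integral_le_of_minors (μ := volume)
      (hint (u + q) 0) (hint (u + q) (q / a)) (hint (u + p + q) 0) (hint (u + p + q) (q / a))
      (fun z w hzw => hh.translate_mul_le (by linarith) (mul_le_mul_of_nonneg_left hzw ha.le))
      (fun z w hzw => by
        have := hk.mul_le (z - q / a) (q / a) (w - z) (by positivity) (by linarith)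
        have e1 : z - q / a + q / a + (w - z) = w := by ring
        have e2 : z - q / a + q / a = z := by ring
        have e3 : z - q / a + (w - z) = w - q / a := by ring
        rw [e1, e2, e3] at this
        rw [sub_zero, sub_zero]; linarith)
    rw [shift, shift, shift, shift, hqa, mul_zero, sub_zero, sub_zero] at key
    have e1 : u + q - q = u := by ring
    have e2 : u + p + q - q = u + p := by ring
    rw [e1, e2] at key
    linarith

end IsPolyaKernel

/-! ### The gamma density of shape at least one -/

theorem gammaPDFReal_one_eq {α x : ℝ} (hx : 0 ≤ x) :
    gammaPDFReal α 1 x = (Real.Gamma α)⁻¹ * (x ^ (α - 1) * Real.exp (-x)) := by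
  rw [gammaPDFReal, if_pos hx, Real.one_rpow, one_mul, one_div, mul_assoc]

theorem gammaPDFReal_of_neg {α r x : ℝ} (hx : x < 0) : gammaPDFReal α r x = 0 := by
  rw [gammaPDFReal, if_neg (not_le.2 hx)]

theorem integrable_gammaPDFReal {α : ℝ} (hα : 0 < α) : Integrable (gammaPDFReal α 1) := by
  refine ⟨(measurable_gammaPDFReal α 1).aestronglyMeasurable, ?_⟩
  rw [hasFiniteIntegral_iff_ofReal (ae_of_all _ (gammaPDFReal_nonneg hα one_pos))]
  change ∫⁻ x, gammaPDF α 1 x < ⊤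
  rw [lintegral_gammaPDF_eq_one hα one_pos]
  exact ENNReal.one_lt_top

theorem rpow_mul_exp_neg_le {p : ℝ} (hp : 0 ≤ p) :
    ∃ C, ∀ x : ℝ, 0 ≤ x → x ^ p * Real.exp (-x) ≤ C := by
  rcases hp.eq_or_lt with rfl | hp
  · exact ⟨1, fun x hx => by simpa using hx⟩
  · refine ⟨p ^ p, fun x hx => ?_⟩
    have h1 : x ≤ p * Real.exp (x / p) := by
      have := Real.add_one_le_exp (x / p)
      calc x = p * (x / p) := by field_simp
        _ ≤ _ := by gcongr; linarith
    have h2 : x ^ p ≤ p ^ p * Real.exp x := by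
      calc x ^ p ≤ (p * Real.exp (x / p)) ^ p := Real.rpow_le_rpow hx h1 hp.le
        _ = p ^ p * Real.exp x := by
          rw [Real.mul_rpow hp.le (Real.exp_pos _).le, ← Real.exp_mul]
          congr 2; field_simp
    calc x ^ p * Real.exp (-x) ≤ p ^ p * Real.exp x * Real.exp (-x) := by gcongr
      _ = p ^ p := by rw [mul_assoc, ← Real.exp_add]; simp

/-- The gamma density is log-concave because its shape is at least one; for smaller shapes it is
unbounded at the origin and log-convex. -/
theorem isPolyaKernel_gammaPDFReal {α : ℝ} (hα : 1 ≤ α) : IsPolyaKernel (gammaPDFReal α 1) where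
  measurable := measurable_gammaPDFReal α 1
  bounded := by
    obtain ⟨C, hC⟩ := rpow_mul_exp_neg_le (sub_nonneg.2 hα)
    have hΓ : 0 < Real.Gamma α := Real.Gamma_pos_of_pos (by linarith)
    refine ⟨(Real.Gamma α)⁻¹ * max C 0, fun x => ?_⟩
    rcases lt_or_ge x 0 with hx | hx
    · rw [gammaPDFReal_of_neg hx]; positivity
    · rw [gammaPDFReal_one_eq hx]
      gcongr
      exact (hC x hx).trans (le_max_left _ _)
  nonneg := gammaPDFReal_nonneg (by linarith) one_pos
  eq_zero x hx := gammaPDFReal_of_neg hx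
  pos x hx := gammaPDFReal_pos (by linarith) one_pos hx
  mul_le u p q hp hq := by
    rcases lt_or_ge u 0 with hu | hu
    · rw [gammaPDFReal_of_neg hu, zero_mul]
      exact mul_nonneg (gammaPDFReal_nonneg (by linarith) one_pos _)
        (gammaPDFReal_nonneg (by linarith) one_pos _)
    · rw [gammaPDFReal_one_eq hu, gammaPDFReal_one_eq (by positivity),
        gammaPDFReal_one_eq (by positivity), gammaPDFReal_one_eq (by positivity)]
      have h1 : u ^ (α - 1) * (u + p + q) ^ (α - 1) ≤ (u + p) ^ (α - 1) * (u + q) ^ (α - 1) := by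
        rw [← Real.mul_rpow hu (by positivity), ← Real.mul_rpow (by positivity) (by positivity)]
        exact Real.rpow_le_rpow (by positivity) (by nlinarith [mul_nonneg hp hq]) (by linarith)
      have h2 : Real.exp (-u) * Real.exp (-(u + p + q)) =
          Real.exp (-(u + p)) * Real.exp (-(u + q)) := by
        rw [← Real.exp_add, ← Real.exp_add]; congr 1; ring
      calc _ = (Real.Gamma α)⁻¹ ^ 2 * (u ^ (α - 1) * (u + p + q) ^ (α - 1)) *
            (Real.exp (-u) * Real.exp (-(u + p + q))) := by ring
        _ ≤ (Real.Gamma α)⁻¹ ^ 2 * ((u + p) ^ (α - 1) * (u + q) ^ (α - 1)) *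
            (Real.exp (-u) * Real.exp (-(u + p + q))) := by gcongr
        _ = _ := by rw [h2]; ring

/-- Integrals against the gamma law are integrals against its density. -/
theorem integral_gammaMeasure {α : ℝ} (hα : 0 < α) (g : ℝ → ℝ) :
    ∫ t, g t ∂(gammaMeasure α 1) = ∫ t, g t * gammaPDFReal α 1 t := by
  have hm : Measurable fun t => (gammaPDFReal α 1 t).toNNReal :=
    (measurable_gammaPDFReal α 1).real_toNNReal
  change ∫ t, g t ∂(volume.withDensity fun t => ((gammaPDFReal α 1 t).toNNReal : ENNReal)) = _
  rw [integral_withDensity_eq_integral_smul hm]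
  congr 1; ext t
  rw [NNReal.smul_def, Real.coe_toNNReal _ (gammaPDFReal_nonneg hα one_pos t), smul_eq_mul,
    mul_comm]

/-- The density of the standard exponential law. -/
noncomputable def expDensity (z : ℝ) : ℝ := if 0 ≤ z then Real.exp (-z) else 0

theorem expDensity_nonneg (z : ℝ) : 0 ≤ expDensity z := by
  unfold expDensity; split_ifs <;> positivity

theorem integrable_expDensity : Integrable expDensity := by
  have : expDensity = gammaPDFReal 1 1 := by
    ext z; simp [expDensity, gammaPDFReal]
  rw [this]
  exact integrable_gammaPDFReal one_pos

theorem isPolyaKernel_expDensity : IsPolyaKernel expDensity := by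
  have : expDensity = gammaPDFReal 1 1 := by
    ext z; simp [expDensity, gammaPDFReal]
  rw [this]
  exact isPolyaKernel_gammaPDFReal le_rfl

/-- Convolving the gamma density of shape `α` with the exponential density gives `α⁻¹` times its
size-biased version: the gamma density of shape `α + 1`. -/
theorem mul_gammaPDFReal_eq_integral {α : ℝ} (hα : 1 ≤ α) (u : ℝ) :
    u * gammaPDFReal α 1 u = α * ∫ z, gammaPDFReal α 1 (u - z) * expDensity z := by
  have hα0 : 0 < α := by linarith
  rcases lt_or_ge u 0 with hu | hu
  · rw [gammaPDFReal_of_neg hu, mul_zero, integral_eq_zero_of_ae, mul_zero]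
    refine ae_of_all _ fun z => ?_
    rcases lt_or_ge z 0 with hz | hz
    · simp [expDensity, hz]
    · simp [gammaPDFReal_of_neg (show u - z < 0 by linarith)]
  · have e : (fun z => gammaPDFReal α 1 (u - z) * expDensity z) =
        indicator (Icc 0 u) fun z => (Real.Gamma α)⁻¹ * Real.exp (-u) * (u - z) ^ (α - 1) := by
      ext z
      by_cases hz : z ∈ Icc 0 u
      · rw [indicator_of_mem hz, gammaPDFReal_one_eq (by linarith [hz.2]), expDensity,
          if_pos hz.1]
        have : Real.exp (-u) = Real.exp (-(u - z)) * Real.exp (-z) := by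
          rw [← Real.exp_add]; congr 1; ring
        rw [this]; ring
      · rw [indicator_of_notMem hz]
        rcases lt_or_ge z 0 with h0 | h0
        · simp [expDensity, h0]
        · rw [gammaPDFReal_of_neg, zero_mul]
          by_contra hc
          exact hz ⟨h0, by linarith⟩
    rw [e, integral_indicator measurableSet_Icc, integral_const_mul, integral_Icc_eq_integral_Ioc,
      ← intervalIntegral.integral_of_le hu,
      intervalIntegral.integral_comp_sub_left (fun y => y ^ (α - 1)) u, sub_self, sub_zero,
      integral_rpow (Or.inl (by linarith)), gammaPDFReal_one_eq hu]
    rw [sub_add_cancel, Real.zero_rpow hα0.ne', sub_zero]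
    rcases hu.eq_or_lt with rfl | hu
    · simp [hα0.ne']
    · have : u ^ α = u * u ^ (α - 1) := by
        rw [← Real.rpow_one_add' hu.le (by linarith)]; congr 1; ring
      rw [this]; field_simp

/-- Likelihood ratio ordering: if `a < b`, the density of `Y + b E` divided by that of `Y + a E`
is strictly increasing on `(0, ∞)`, where `Y` has the log-concave density `h` and `E` is an
independent standard exponential variable. -/
theorem IsPolyaKernel.exponential_ratio_lt {h : ℝ → ℝ} (hh : IsPolyaKernel h) {a b x y : ℝ}
    (ha : 0 < a) (hab : a < b) (hx : 0 < x) (hxy : x < y) :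
    (∫ z, h (x - b * z) * expDensity z) * (∫ z, h (y - a * z) * expDensity z) <
      (∫ z, h (x - a * z) * expDensity z) * (∫ z, h (y - b * z) * expDensity z) := by
  have hb : 0 < b := ha.trans hab
  have scale : ∀ (c : ℝ), 0 < c → ∀ X : ℝ,
      ∫ z, h (X - z) * expDensity (z / c) = c * ∫ z, h (X - c * z) * expDensity z := by
    intro c hc X
    have := Measure.integral_comp_mul_left (fun z => h (X - z) * expDensity (z / c)) c
    simp only [mul_div_cancel_left₀ _ hc.ne', smul_eq_mul, abs_of_pos (inv_pos.2 hc)] at this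
    rw [this]; field_simp
  have hint : ∀ (c : ℝ), 0 < c → ∀ X : ℝ,
      Integrable fun z => h (X - z) * expDensity (z / c) := fun c hc X =>
    hh.integrable_mul (by fun_prop) (integrable_expDensity.comp_div hc.ne')
  have expo : ∀ z w : ℝ, 0 ≤ z → z < w → expDensity (w / a) * expDensity (z / b) <
      expDensity (z / a) * expDensity (w / b) := by
    intro z w hz hzw
    have hw : 0 ≤ w := by linarith
    simp only [expDensity, if_pos (div_nonneg hz ha.le), if_pos (div_nonneg hz hb.le),
      if_pos (div_nonneg hw ha.le), if_pos (div_nonneg hw hb.le)]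
    rw [← Real.exp_add, ← Real.exp_add]
    refine Real.exp_lt_exp.2 ?_
    have h1 : 1 / b < 1 / a := one_div_lt_one_div_of_lt ha hab
    have := mul_pos (sub_pos.2 h1) (sub_pos.2 hzw)
    simp only [div_eq_mul_one_div z, div_eq_mul_one_div w]
    nlinarith
  have key := integral_mul_integral_lt_of_minors (μ := volume) (s := Ioo 0 x) (t := Ioo x y)
    (hint a ha x) (hint b hb x) (hint a ha y) (hint b hb y)
    (fun z w hzw => hh.translate_mul_le hxy.le hzw)
    (fun z w hzw => by
      rcases lt_or_ge z 0 with hz | hz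
      · have : expDensity (z / b) = 0 := if_neg (not_le.2 (div_neg_of_neg_of_pos hz hb))
        rw [this, mul_zero]
        exact mul_nonneg (expDensity_nonneg _) (expDensity_nonneg _)
      · rcases hzw.eq_or_lt with rfl | hzw
        · exact le_rfl
        · exact (expo z w hz hzw).le)
    (by simp [hx]) (by simp [hxy])
    (fun z hz w hw => by
      refine ⟨?_, expo z w hz.1.le (hz.2.trans hw.1)⟩
      rw [hh.eq_zero (x - w) (by linarith [hw.1]), zero_mul]
      exact mul_pos (hh.pos _ (by linarith [hz.2])) (hh.pos _ (by linarith [hw.2])))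
  rw [scale a ha, scale b hb, scale a ha, scale b hb] at key
  have hab' : 0 < a * b := mul_pos ha hb
  refine lt_of_mul_lt_mul_left ?_ hab'.le
  linarith

/-! ### The gamma distribution function -/

theorem gammaCDF_sub_eq {α : ℝ} (hα : 1 ≤ α) (u v : ℝ) :
    cdf (gammaMeasure α 1) v - cdf (gammaMeasure α 1) u = ∫ t in u..v, gammaPDFReal α 1 t := by
  have hα0 : 0 < α := by linarith
  have hi := integrable_gammaPDFReal hα0
  rw [cdf_gammaMeasure_eq_integral hα0 one_pos, cdf_gammaMeasure_eq_integral hα0 one_pos,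
    intervalIntegral.integral_Iic_sub_Iic hi.integrableOn hi.integrableOn]

theorem exists_lipschitz_gammaCDF {α : ℝ} (hα : 1 ≤ α) :
    ∃ C : NNReal, LipschitzWith C (cdf (gammaMeasure α 1)) := by
  obtain ⟨C, hC0, hC⟩ := (isPolyaKernel_gammaPDFReal hα).exists_abs_le
  refine ⟨⟨C, hC0⟩, LipschitzWith.of_dist_le_mul fun u v => ?_⟩
  rw [Real.dist_eq, Real.dist_eq, gammaCDF_sub_eq hα]
  exact intervalIntegral.norm_integral_le_of_norm_le_const (C := C)
    (f := gammaPDFReal α 1) (fun t _ => hC t)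

theorem hasDerivAt_gammaCDF {α : ℝ} (hα : 1 ≤ α) {u : ℝ} (hu : u ≠ 0) :
    HasDerivAt (cdf (gammaMeasure α 1)) (gammaPDFReal α 1 u) u := by
  have hc : ContinuousAt (gammaPDFReal α 1) u := by
    rcases hu.lt_or_gt with h | h
    · refine (continuousAt_const (y := (0 : ℝ))).congr ?_
      filter_upwards [Iio_mem_nhds h] with t ht
      exact (gammaPDFReal_of_neg ht).symm
    · have : ContinuousAt (fun t => (Real.Gamma α)⁻¹ * (t ^ (α - 1) * Real.exp (-t))) u :=
        continuousAt_const.mul ((Real.continuousAt_rpow_const _ _ (Or.inl hu)).mul (by fun_prop))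
      refine this.congr ?_
      filter_upwards [Ioi_mem_nhds h] with t ht
      exact (gammaPDFReal_one_eq (le_of_lt ht)).symm
  have hi := integrable_gammaPDFReal (show 0 < α by linarith)
  have h := intervalIntegral.integral_hasDerivAt_right (a := u)
    hi.intervalIntegrable
    ((measurable_gammaPDFReal α 1).stronglyMeasurable.stronglyMeasurableAtFilter) hc
  have e : cdf (gammaMeasure α 1) = fun v =>
      cdf (gammaMeasure α 1) u + ∫ t in u..v, gammaPDFReal α 1 t := by
    ext v; rw [← gammaCDF_sub_eq hα]; ring
  rw [e]
  exact h.const_add _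

/-! ### Sums of independent gamma variables -/

theorem integrable_id_mul_gammaPDFReal {α : ℝ} (hα : 0 < α) :
    Integrable fun t => t * gammaPDFReal α 1 t := by
  have e : (fun t => t * gammaPDFReal α 1 t) = fun t => α * gammaPDFReal (α + 1) 1 t := by
    ext t
    rcases lt_or_ge t 0 with ht | ht
    · simp [gammaPDFReal_of_neg ht]
    · rw [gammaPDFReal_one_eq ht, gammaPDFReal_one_eq ht, Real.Gamma_add_one hα.ne',
        add_sub_cancel_right]
      have : t ^ α = t * t ^ (α - 1) := by
        rw [← Real.rpow_one_add' ht (by linarith)]; congr 1; ring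
      rw [this]; field_simp
  rw [e]
  exact (integrable_gammaPDFReal (by linarith)).const_mul α

theorem integrable_gammaMeasure {α : ℝ} (hα : 0 < α) {g : ℝ → ℝ}
    (hg : Integrable fun t => g t * gammaPDFReal α 1 t) : Integrable g (gammaMeasure α 1) := by
  have hm : Measurable fun t => (gammaPDFReal α 1 t).toNNReal :=
    (measurable_gammaPDFReal α 1).real_toNNReal
  change Integrable g (volume.withDensity fun t => ((gammaPDFReal α 1 t).toNNReal : ENNReal))
  rw [integrable_withDensity_iff_integrable_smul hm]
  refine hg.congr (ae_of_all _ fun t => ?_)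
  simp only [NNReal.smul_def, Real.coe_toNNReal _ (gammaPDFReal_nonneg hα one_pos t), smul_eq_mul,
    mul_comm]

/-- `X` is an independent family of (everywhere) measurable random variables, all with the gamma
law of shape `α ≥ 1` and scale `1`. -/
structure IsGammaFamily {Ω : Type*} [MeasurableSpace Ω] (P : Measure Ω) {n : ℕ} (α : ℝ)
    (X : Fin n → Ω → ℝ) : Prop where
  one_le : 1 ≤ α
  measurable : ∀ i, Measurable (X i)
  map_eq : ∀ i, P.map (X i) = gammaMeasure α 1
  indep : iIndepFun X P

/-- The part of the weighted sum which is indexed by `s`. -/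
def partialSum {Ω : Type*} {n : ℕ} (X : Fin n → Ω → ℝ) (w : Fin n → ℝ) (s : Finset (Fin n))
    (ω : Ω) : ℝ := ∑ l ∈ s, w l * X l ω

namespace IsGammaFamily

variable {Ω : Type*} [MeasurableSpace Ω] {P : Measure Ω} {n : ℕ}
  {α : ℝ} {X : Fin n → Ω → ℝ}

theorem pos (hX : IsGammaFamily P α X) : 0 < α := zero_lt_one.trans_le hX.one_le

theorem measurable_partialSum (hX : IsGammaFamily P α X) (w : Fin n → ℝ) (s : Finset (Fin n)) :
    Measurable (partialSum X w s) :=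
  Finset.measurable_sum s fun l _ => (hX.measurable l).const_mul _

theorem integrable (hX : IsGammaFamily P α X) (i : Fin n) : Integrable (X i) P := by
  have h : Integrable (fun t : ℝ => t) (P.map (X i)) := by
    rw [hX.map_eq]
    exact integrable_gammaMeasure hX.pos (integrable_id_mul_gammaPDFReal hX.pos)
  exact h.comp_measurable (hX.measurable i)

theorem integrable_partialSum (hX : IsGammaFamily P α X) (w : Fin n → ℝ) (s : Finset (Fin n)) :
    Integrable (partialSum X w s) P :=
  integrable_finsetSum s fun l _ => (hX.integrable l).const_mul _

theorem ae_nonneg (hX : IsGammaFamily P α X) : ∀ᵐ ω ∂P, ∀ i, 0 ≤ X i ω := by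
  rw [ae_all_iff]
  intro i
  have h : ∀ᵐ t ∂(P.map (X i)), 0 ≤ t := by
    rw [hX.map_eq, ae_iff, gammaMeasure]
    simp only [not_le]
    change (volume.withDensity (gammaPDF α 1)) (Iio 0) = 0
    rw [withDensity_apply _ measurableSet_Iio]
    exact lintegral_gammaPDF_of_nonpos le_rfl
  exact ae_of_ae_map (hX.measurable i).aemeasurable h

theorem indepFun_partialSum (hX : IsGammaFamily P α X) (w : Fin n → ℝ) {s : Finset (Fin n)}
    {i : Fin n} (hi : i ∉ s) : IndepFun (X i) (partialSum X w s) P := by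
  -- rescaling the variables of `s` only leaves `X i` itself in the family
  have h := (hX.indep.comp (fun l t => (if l = i then 1 else w l) * t)
    (fun l => measurable_id.const_mul _)).indepFun_finsetSum_of_notMem
    (fun l => (measurable_id.const_mul _).comp (hX.measurable l)) hi
  have e1 : (∑ j ∈ s, ((fun t => (if j = i then 1 else w j) * t) ∘ X j)) = partialSum X w s := by
    ext ω
    simp only [Finset.sum_apply, Function.comp, partialSum]
    refine Finset.sum_congr rfl fun l hl => ?_
    rw [if_neg (ne_of_mem_of_not_mem hl hi)]
  have e2 : ((fun t => (if i = i then 1 else w i) * t) ∘ X i) = X i := by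
    ext ω; simp
  rw [e1, e2] at h
  exact h.symm

variable [IsProbabilityMeasure P]

theorem map_prod_eq (hX : IsGammaFamily P α X) (w : Fin n → ℝ) {s : Finset (Fin n)} {i : Fin n}
    (hi : i ∉ s) : P.map (fun ω => (X i ω, partialSum X w s ω)) =
      (gammaMeasure α 1).prod (P.map (partialSum X w s)) := by
  rw [← hX.map_eq i]
  exact (indepFun_iff_map_prod_eq_prod_map_map (hX.measurable i).aemeasurable
    (hX.measurable_partialSum w s).aemeasurable).1 (hX.indepFun_partialSum w hi)

/-- Fubini for the independent variables `X i` and `partialSum X w s`, in both orders. -/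
theorem integral_eq_integral_integral (hX : IsGammaFamily P α X) (w : Fin n → ℝ)
    {s : Finset (Fin n)} {i : Fin n} (hi : i ∉ s) {φ : ℝ × ℝ → ℝ} (hφ : Measurable φ)
    (hint : Integrable (fun ω => φ (X i ω, partialSum X w s ω)) P) :
    ∫ ω, φ (X i ω, partialSum X w s ω) ∂P =
        ∫ ω, ∫ t, φ (t, partialSum X w s ω) ∂(gammaMeasure α 1) ∂P ∧
    ∫ ω, φ (X i ω, partialSum X w s ω) ∂P =
        ∫ t, ∫ ω, φ (t, partialSum X w s ω) ∂P ∂(gammaMeasure α 1) := by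
  have := isProbabilityMeasure_gammaMeasure hX.pos one_pos
  have hS := hX.measurable_partialSum w s
  have hXS : Measurable fun ω => (X i ω, partialSum X w s ω) := (hX.measurable i).prodMk hS
  have hi' : Integrable φ ((gammaMeasure α 1).prod (P.map (partialSum X w s))) := by
    rw [← hX.map_prod_eq w hi]
    exact (integrable_map_measure hφ.aestronglyMeasurable hXS.aemeasurable).2 hint
  have hPS : IsProbabilityMeasure (P.map (partialSum X w s)) :=
    Measure.isProbabilityMeasure_map hS.aemeasurable
  have e : ∫ ω, φ (X i ω, partialSum X w s ω) ∂P =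
      ∫ p, φ p ∂((gammaMeasure α 1).prod (P.map (partialSum X w s))) := by
    rw [← hX.map_prod_eq w hi, integral_map hXS.aemeasurable hφ.aestronglyMeasurable]
  constructor
  · rw [e, integral_prod_symm φ hi', integral_map hS.aemeasurable]
    exact hφ.stronglyMeasurable.integral_prod_left'.aestronglyMeasurable
  · rw [e, integral_prod φ hi']
    congr 1; ext t
    rw [integral_map hS.aemeasurable]
    exact (hφ.comp measurable_prodMk_left).aestronglyMeasurable

/-- The distribution function of the weighted sum, conditionally on all variables but `X i`. -/
theorem weightedSumCDF_eq (hX : IsGammaFamily P α X) {w : Fin n → ℝ} {i : Fin n} (hw : 0 < w i)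
    (x : ℝ) : weightedSumCDF P X w x =
      ∫ ω, cdf (gammaMeasure α 1) ((x - partialSum X w (Finset.univ.erase i) ω) / w i) ∂P := by
  have := isProbabilityMeasure_gammaMeasure hX.pos one_pos
  have hsplit : ∀ ω, ∑ l, w l * X l ω =
      w i * X i ω + partialSum X w (Finset.univ.erase i) ω := fun ω =>
    (Finset.add_sum_erase _ _ (Finset.mem_univ i)).symm
  have hm : Measurable fun ω => ∑ l, w l * X l ω := hX.measurable_partialSum w Finset.univ
  have hPS : IsProbabilityMeasure (P.map fun ω => ∑ l, w l * X l ω) :=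
    Measure.isProbabilityMeasure_map hm.aemeasurable
  have hs : MeasurableSet {p : ℝ × ℝ | w i * p.1 + p.2 ≤ x} :=
    measurableSet_le (by fun_prop) measurable_const
  have hφ : Measurable (indicator {p : ℝ × ℝ | w i * p.1 + p.2 ≤ x} fun _ => (1 : ℝ)) :=
    measurable_const.indicator hs
  have hXS : Measurable fun ω => (X i ω, partialSum X w (Finset.univ.erase i) ω) :=
    (hX.measurable i).prodMk (hX.measurable_partialSum w _)
  rw [weightedSumCDF, cdf_eq_real, map_measureReal_apply hm measurableSet_Iic]
  have h1 := (hX.integral_eq_integral_integral w (Finset.notMem_erase i Finset.univ) hφ (by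
    refine Integrable.of_bound (hφ.comp hXS).aestronglyMeasurable 1 (ae_of_all _ fun ω => ?_)
    simp only [indicator, Real.norm_eq_abs]
    split_ifs <;> simp)).1
  have e1 : ∫ ω, indicator {p : ℝ × ℝ | w i * p.1 + p.2 ≤ x} (fun _ => (1 : ℝ))
      (X i ω, partialSum X w (Finset.univ.erase i) ω) ∂P =
      P.real ((fun ω => ∑ l, w l * X l ω) ⁻¹' Iic x) := by
    rw [← integral_indicator_one (hm measurableSet_Iic)]
    congr 1; ext ω
    simp only [indicator, mem_ofPred_eq, mem_preimage, mem_Iic, hsplit, Pi.one_apply]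
  rw [← e1, h1]
  congr 1; ext ω
  rw [cdf_eq_real, ← integral_indicator_one measurableSet_Iic]
  congr 1; ext t
  simp only [indicator, mem_ofPred_eq, mem_Iic, Pi.one_apply, le_div_iff₀ hw]
  congr 1
  apply propext
  constructor <;> intro h <;> linarith

theorem integral_partialSum_insert (hX : IsGammaFamily P α X) (w : Fin n → ℝ)
    {s : Finset (Fin n)} {i : Fin n} (hi : i ∉ s) {h : ℝ → ℝ} (hh : IsPolyaKernel h) (x : ℝ) :
    ∫ ω, h (x - partialSum X w (insert i s) ω) ∂P =
      ∫ ω, (∫ t, h (x - partialSum X w s ω - w i * t) * gammaPDFReal α 1 t) ∂P := by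
  have hφ : Measurable fun p : ℝ × ℝ => h (x - (w i * p.1 + p.2)) :=
    hh.measurable.comp (by fun_prop)
  have hS := hX.measurable_partialSum w s
  have hXi := hX.measurable i
  have h4 := (hX.integral_eq_integral_integral w hi hφ
    (hh.integrable_comp (by fun_prop))).1
  have e : ∀ ω, partialSum X w (insert i s) ω = w i * X i ω + partialSum X w s ω := fun ω =>
    Finset.sum_insert hi
  simp only [e]
  rw [h4]
  congr 1; ext ω
  rw [integral_gammaMeasure hX.pos]
  congr 1; ext t
  congr 2; ring

/-- Adding independent positive multiples of the `X l` preserves Pólya kernels. -/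
theorem isPolyaKernel_average (hX : IsGammaFamily P α X) {w : Fin n → ℝ} {s : Finset (Fin n)}
    (hw : ∀ l ∈ s, 0 < w l) {h : ℝ → ℝ} (hh : IsPolyaKernel h) :
    IsPolyaKernel fun x => ∫ ω, h (x - partialSum X w s ω) ∂P := by
  induction s using Finset.induction_on generalizing h with
  | empty => simpa [partialSum] using hh
  | insert i s hi ih =>
    have h2 := hh.convolution (isPolyaKernel_gammaPDFReal hX.one_le)
      (integrable_gammaPDFReal hX.pos) (hw i (Finset.mem_insert_self i s))
    have h3 := ih (fun l hl => hw l (Finset.mem_insert_of_mem hl)) h2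
    convert h3 using 2 with x
    exact hX.integral_partialSum_insert w hi hh x

/-- A partial sum with at least one term has no atoms. -/
theorem ae_partialSum_ne (hX : IsGammaFamily P α X) {w : Fin n → ℝ} {s : Finset (Fin n)}
    {j : Fin n} (hj : j ∈ s) (hw : 0 < w j) (x : ℝ) : ∀ᵐ ω ∂P, partialSum X w s ω ≠ x := by
  have := isProbabilityMeasure_gammaMeasure hX.pos one_pos
  have hPS : IsProbabilityMeasure (P.map (partialSum X w (s.erase j))) :=
    Measure.isProbabilityMeasure_map (hX.measurable_partialSum w _).aemeasurable
  have hXS : Measurable fun ω => (X j ω, partialSum X w (s.erase j) ω) :=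
    (hX.measurable j).prodMk (hX.measurable_partialSum w _)
  have hms : MeasurableSet {p : ℝ × ℝ | w j * p.1 + p.2 ≠ x} :=
    (measurableSet_eq_fun (by fun_prop) measurable_const).compl
  have h : ∀ᵐ p ∂((gammaMeasure α 1).prod (P.map (partialSum X w (s.erase j)))),
      w j * p.1 + p.2 ≠ x := by
    rw [← Measure.prod_swap, ae_map_iff measurable_swap.aemeasurable hms]
    refine (Measure.ae_prod_iff_ae_ae (p := fun q : ℝ × ℝ => w j * q.2 + q.1 ≠ x)
      (measurable_swap hms)).2 ?_
    refine ae_of_all _ fun y => ?_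
    have hac : gammaMeasure α 1 ≪ volume := withDensity_absolutelyContinuous _ _
    refine hac.ae_le ?_
    filter_upwards [(measure_eq_zero_iff_ae_notMem (μ := volume) (s := {(x - y) / w j})).1
      (measure_singleton _)] with t ht hc
    apply ht
    rw [mem_singleton_iff, eq_div_iff hw.ne']
    linarith
  rw [← hX.map_prod_eq w (Finset.notMem_erase j s)] at h
  filter_upwards [ae_of_ae_map hXS.aemeasurable h] with ω hω
  rwa [partialSum, ← Finset.add_sum_erase _ _ hj]

/-! ### Continuity and monotonicity of the distribution function -/

theorem integrable_gammaCDF_comp (hX : IsGammaFamily P α X) {T : Ω → ℝ} (hT : Measurable T) :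
    Integrable (fun ω => cdf (gammaMeasure α 1) (T ω)) P := by
  obtain ⟨C, hC⟩ := exists_lipschitz_gammaCDF hX.one_le
  refine Integrable.of_bound (hC.continuous.measurable.comp hT).aestronglyMeasurable 1
    (ae_of_all _ fun ω => ?_)
  rw [Real.norm_eq_abs, abs_of_nonneg (cdf_nonneg _ _)]
  exact cdf_le_one _ _

theorem continuousOn_weightedSumCDF (hX : IsGammaFamily P α X) (i : Fin n) :
    ContinuousOn (fun p : ℝ × (Fin n → ℝ) => weightedSumCDF P X p.2 p.1) {p | 0 < p.2 i} := by
  obtain ⟨C, hC⟩ := exists_lipschitz_gammaCDF hX.one_le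
  refine ContinuousOn.congr (f := fun p : ℝ × (Fin n → ℝ) => ∫ ω, cdf (gammaMeasure α 1)
    ((p.1 - partialSum X p.2 (Finset.univ.erase i) ω) / p.2 i) ∂P) ?_
    fun p hp => hX.weightedSumCDF_eq hp p.1
  refine continuousOn_of_dominated (bound := fun _ => 1) (fun p _ => ?_) (fun p _ => ?_)
    (integrable_const 1) (ae_of_all _ fun ω => ?_)
  · exact (hX.integrable_gammaCDF_comp
      ((measurable_const.sub (hX.measurable_partialSum _ _)).div_const _)).aestronglyMeasurable
  · refine ae_of_all _ fun ω => ?_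
    rw [Real.norm_eq_abs, abs_of_nonneg (cdf_nonneg _ _)]
    exact cdf_le_one _ _
  · refine hC.continuous.comp_continuousOn (ContinuousOn.div ?_ ?_ fun p hp => ?_)
    · unfold partialSum; fun_prop
    · fun_prop
    · exact (show 0 < p.2 i from hp).ne'

theorem weightedSumCDF_eq_measureReal (hX : IsGammaFamily P α X) (w : Fin n → ℝ) (x : ℝ) :
    weightedSumCDF P X w x = P.real {ω | partialSum X w Finset.univ ω ≤ x} := by
  have hm := hX.measurable_partialSum w Finset.univ
  have hPS : IsProbabilityMeasure (P.map (partialSum X w Finset.univ)) :=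
    Measure.isProbabilityMeasure_map hm.aemeasurable
  change cdf (P.map (partialSum X w Finset.univ)) x = _
  rw [cdf_eq_real, map_measureReal_apply hm measurableSet_Iic]
  rfl

theorem weightedSumCDF_anti (hX : IsGammaFamily P α X) {w w' : Fin n → ℝ} (hw : w ≤ w') (x : ℝ) :
    weightedSumCDF P X w' x ≤ weightedSumCDF P X w x := by
  rw [hX.weightedSumCDF_eq_measureReal, hX.weightedSumCDF_eq_measureReal]
  refine ENNReal.toReal_mono (measure_ne_top _ _) (measure_mono_ae ?_)
  filter_upwards [hX.ae_nonneg] with ω hω h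
  exact (Finset.sum_le_sum fun l _ => mul_le_mul_of_nonneg_right (hw l) (hω l)).trans h

end IsGammaFamily

/-! ### Derivatives in the weights -/

/-- The density of the weighted sum `∑ l, w l * X l`, obtained by conditioning on all variables but
`X i` (up to the constant factor `w i`). -/
noncomputable def sumDensity {Ω : Type*} [MeasurableSpace Ω] (P : Measure Ω) {n : ℕ} (α : ℝ) (X : Fin n → Ω → ℝ) (w : Fin n → ℝ)
    (i : Fin n) (x : ℝ) : ℝ :=
  ∫ ω, gammaPDFReal α 1 ((x - partialSum X w (Finset.univ.erase i) ω) / w i) ∂P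

/-- The density of `∑ l, w l * X l + c * E`, up to the same factor `w i` as in `sumDensity`, where
`E` is an independent standard exponential variable. -/
noncomputable def sumDensityExp {Ω : Type*} [MeasurableSpace Ω] (P : Measure Ω) {n : ℕ} (α : ℝ) (X : Fin n → Ω → ℝ) (w : Fin n → ℝ)
    (i : Fin n) (c x : ℝ) : ℝ :=
  ∫ z, sumDensity P α X w i (x - c * z) * expDensity z

/-- The weight vector with the `i`-th weight raised by `ε` and the `j`-th lowered by `ρ`. -/
def transfer {n : ℕ} (w : Fin n → ℝ) (i j : Fin n) (ε ρ : ℝ) : Fin n → ℝ :=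
  Function.update (Function.update w i (w i + ε)) j (w j - ρ)

theorem partialSum_transfer {Ω : Type*} {n : ℕ} {X : Fin n → Ω → ℝ} {w : Fin n → ℝ} {i j : Fin n}
    (hij : i ≠ j) (ε ρ : ℝ) (ω : Ω) :
    partialSum X (transfer w i j ε ρ) (Finset.univ.erase i) ω =
      partialSum X w (Finset.univ.erase i) ω - ρ * X j ω := by
  have hj : j ∈ Finset.univ.erase i := Finset.mem_erase.2 ⟨hij.symm, Finset.mem_univ j⟩
  rw [partialSum, partialSum, ← Finset.add_sum_erase _ _ hj, ← Finset.add_sum_erase _ _ hj]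
  have : ∑ l ∈ (Finset.univ.erase i).erase j, transfer w i j ε ρ l * X l ω =
      ∑ l ∈ (Finset.univ.erase i).erase j, w l * X l ω := by
    refine Finset.sum_congr rfl fun l hl => ?_
    have h1 : l ≠ j := Finset.ne_of_mem_erase hl
    have h2 : l ≠ i := Finset.ne_of_mem_erase (Finset.mem_of_mem_erase hl)
    simp [transfer, h1, h2]
  rw [this]
  simp only [transfer, Function.update_self]
  ring

namespace IsGammaFamily

variable {Ω : Type*} [MeasurableSpace Ω] {P : Measure Ω} [IsProbabilityMeasure P] {n : ℕ}
  {α : ℝ} {X : Fin n → Ω → ℝ}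

/-- Differentiation of `t ↦ E G((c + t d) / (a + t))` under the integral, `G` being the gamma
distribution function. For shape one, `G` has a corner at the origin, so `c` must be almost surely
nonzero. -/
theorem hasDerivAt_integral_gammaCDF (hX : IsGammaFamily P α X) {c d : Ω → ℝ} {a : ℝ}
    (ha : 0 < a) (hcm : Measurable c) (hdm : Measurable d) (hc : Integrable c P)
    (hd : Integrable d P) (hne : ∀ᵐ ω ∂P, c ω ≠ 0) :
    HasDerivAt (fun t => ∫ ω, cdf (gammaMeasure α 1) ((c ω + t * d ω) / (a + t)) ∂P)
      (∫ ω, gammaPDFReal α 1 (c ω / a) * ((d ω - c ω / a) / a) ∂P) 0 := by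
  obtain ⟨C, hC⟩ := exists_lipschitz_gammaCDF hX.one_le
  refine (hasDerivAt_integral_of_dominated_loc_of_lip
    (bound := fun ω => C * (4 / a ^ 2 * |d ω * a - c ω|))
    (Metric.ball_mem_nhds (0 : ℝ) (half_pos ha)) (Eventually.of_forall fun t => ?_) ?_ ?_
    (ae_of_all _ fun ω => ?_) ?_ ?_).2
  · exact (hX.integrable_gammaCDF_comp (by fun_prop)).aestronglyMeasurable
  · exact hX.integrable_gammaCDF_comp (by fun_prop)
  · exact ((measurable_gammaPDFReal α 1).comp (hcm.div_const a)).mul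
      ((hdm.sub (hcm.div_const a)).div_const a) |>.aestronglyMeasurable
  · refine LipschitzOnWith.of_dist_le_mul fun t ht t' ht' => ?_
    rw [Metric.mem_ball, dist_zero_right, Real.norm_eq_abs, abs_lt] at ht ht'
    have h1 : a / 2 ≤ a + t := by linarith [ht.1]
    have h2 : a / 2 ≤ a + t' := by linarith [ht'.1]
    have p1 : 0 < a + t := by linarith
    have p2 : 0 < a + t' := by linarith
    have e : (c ω + t * d ω) / (a + t) - (c ω + t' * d ω) / (a + t') =
        (d ω * a - c ω) * (t - t') / ((a + t) * (a + t')) := by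
      field_simp; ring
    refine (hC.dist_le_mul _ _).trans ?_
    have hb : 0 ≤ (C : ℝ) * (4 / a ^ 2 * |d ω * a - c ω|) := by positivity
    rw [Real.coe_nnabs, abs_of_nonneg hb, Real.dist_eq, Real.dist_eq, e, abs_div, abs_mul,
      abs_of_pos (mul_pos p1 p2), mul_assoc]
    refine mul_le_mul_of_nonneg_left ?_ C.coe_nonneg
    rw [div_le_iff₀ (mul_pos p1 p2)]
    have h3 : 1 ≤ 4 / a ^ 2 * ((a + t) * (a + t')) := by
      rw [div_mul_eq_mul_div, le_div_iff₀ (by positivity)]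
      nlinarith
    calc |d ω * a - c ω| * |t - t'| = |d ω * a - c ω| * |t - t'| * 1 := by ring
      _ ≤ |d ω * a - c ω| * |t - t'| * (4 / a ^ 2 * ((a + t) * (a + t'))) := by gcongr
      _ = _ := by ring
  · exact ((((hd.mul_const a).sub hc).abs).const_mul _).const_mul _
  · filter_upwards [hne] with ω hω
    have h1 : HasDerivAt (fun t => (c ω + t * d ω) / (a + t)) ((d ω - c ω / a) / a) 0 := by
      have hn : HasDerivAt (fun t : ℝ => c ω + t * d ω) (d ω) 0 := by
        simpa using ((hasDerivAt_id (0 : ℝ)).mul_const (d ω)).const_add (c ω)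
      have hdn : HasDerivAt (fun t : ℝ => a + t) 1 0 := by
        simpa using (hasDerivAt_id (0 : ℝ)).const_add a
      have := hn.div hdn (by simpa using ha.ne')
      have e : (d ω * (a + 0) - (c ω + 0 * d ω) * 1) / (a + 0) ^ 2 = (d ω - c ω / a) / a := by
        field_simp; ring
      rwa [e] at this
    have h2 : HasDerivAt (cdf (gammaMeasure α 1)) (gammaPDFReal α 1 (c ω / a))
        ((c ω + 0 * d ω) / (a + 0)) := by
      simpa using hasDerivAt_gammaCDF hX.one_le (div_ne_zero hω ha.ne')
    exact h2.comp (0 : ℝ) h1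

theorem isPolyaKernel_sumDensity (hX : IsGammaFamily P α X) {w : Fin n → ℝ} (hw : ∀ l, 0 < w l)
    (i : Fin n) : IsPolyaKernel (sumDensity P α X w i) :=
  hX.isPolyaKernel_average (fun l _ => hw l)
    ((isPolyaKernel_gammaPDFReal hX.one_le).comp_div (hw i))

theorem sumDensityExp_pos (hX : IsGammaFamily P α X) {w : Fin n → ℝ} (hw : ∀ l, 0 < w l)
    (i : Fin n) {c x : ℝ} (hc : 0 < c) (hx : 0 < x) : 0 < sumDensityExp P α X w i c x :=
  ((hX.isPolyaKernel_sumDensity hw i).convolution isPolyaKernel_expDensity integrable_expDensity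
    hc).pos x hx

/-- The derivative of the distribution function in `w i` is an exponentially smoothed density: this
is `mul_gammaPDFReal_eq_integral` averaged over the variables other than `X i`. -/
theorem integral_gammaPDFReal_mul_self (hX : IsGammaFamily P α X) {w : Fin n → ℝ} {i : Fin n}
    (hw : 0 < w i) (x : ℝ) :
    ∫ ω, gammaPDFReal α 1 ((x - partialSum X w (Finset.univ.erase i) ω) / w i) *
      ((x - partialSum X w (Finset.univ.erase i) ω) / w i) ∂P =
      α * sumDensityExp P α X w i (w i) x := by
  have hS := hX.measurable_partialSum w (Finset.univ.erase i)
  simp_rw [mul_comm (gammaPDFReal α 1 _) _, mul_gammaPDFReal_eq_integral hX.one_le]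
  rw [integral_const_mul, sumDensityExp, integral_integral_swap]
  · congr 2; ext z
    rw [integral_mul_const, sumDensity]
    congr 2; ext ω
    congr 1
    field_simp
    ring
  · exact (isPolyaKernel_gammaPDFReal hX.one_le).integrable_mul
      (T := fun p : Ω × ℝ => (x - partialSum X w (Finset.univ.erase i) p.1) / w i - p.2)
      (by fun_prop) (integrable_expDensity.comp_snd P)

/-- The counterpart of `integral_gammaPDFReal_mul_self` for the derivative in `w j`: the factor
`X j` size-biases the law of `X j`, which amounts to adding an exponential variable to it. -/
theorem integral_gammaPDFReal_mul_other (hX : IsGammaFamily P α X) {w : Fin n → ℝ} {i j : Fin n}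
    (hij : i ≠ j) (hw : ∀ l, 0 < w l) (x : ℝ) :
    ∫ ω, gammaPDFReal α 1 ((x - partialSum X w (Finset.univ.erase i) ω) / w i) * X j ω ∂P =
      α * sumDensityExp P α X w i (w j) x := by
  set f := gammaPDFReal α 1 with hf
  have hpf := isPolyaKernel_gammaPDFReal hX.one_le
  have hfi := integrable_gammaPDFReal hX.pos
  set s := (Finset.univ.erase i).erase j with hs
  have hjs : j ∉ s := Finset.notMem_erase _ _
  have hS := hX.measurable_partialSum w s
  have hXj := hX.measurable j
  have hsplit : ∀ ω, partialSum X w (Finset.univ.erase i) ω = w j * X j ω + partialSum X w s ω :=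
    fun ω => (Finset.add_sum_erase _ _ (Finset.mem_erase.2 ⟨hij.symm, Finset.mem_univ j⟩)).symm
  have hk : IsPolyaKernel fun x => ∫ ω, f ((x - partialSum X w s ω) / w i) ∂P :=
    hX.isPolyaKernel_average (fun l _ => hw l) (hpf.comp_div (hw i))
  set k : ℝ → ℝ := fun x => ∫ ω, f ((x - partialSum X w s ω) / w i) ∂P with hkdef
  -- conditioning on `X j` and the remaining sum
  have h1 : ∀ x, sumDensity P α X w i x = ∫ t, k (x - w j * t) * f t := by
    intro x
    have hφ : Measurable fun p : ℝ × ℝ => f ((x - (w j * p.1 + p.2)) / w i) :=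
      hpf.measurable.comp (by fun_prop)
    have := (hX.integral_eq_integral_integral w hjs hφ (hpf.integrable_comp (by fun_prop))).2
    simp only [sumDensity, hsplit]
    rw [this, integral_gammaMeasure hX.pos]
    simp only [hkdef, sub_sub]
    rfl
  have h2 : ∫ ω, f ((x - partialSum X w (Finset.univ.erase i) ω) / w i) * X j ω ∂P =
      ∫ t, k (x - w j * t) * (t * f t) := by
    have hφ : Measurable fun p : ℝ × ℝ => f ((x - (w j * p.1 + p.2)) / w i) * p.1 :=
      (hpf.measurable.comp (by fun_prop)).mul measurable_fst
    have := (hX.integral_eq_integral_integral w hjs hφ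
      (hpf.integrable_mul (by fun_prop) (hX.integrable j))).2
    simp only [hsplit]
    rw [this, integral_gammaMeasure hX.pos]
    congr 1; ext t
    rw [integral_mul_const, mul_assoc]
    simp only [hkdef, sub_sub]
    rfl
  rw [h2]
  simp_rw [hf, mul_gammaPDFReal_eq_integral hX.one_le, ← hf]
  have h3 : ∀ t, k (x - w j * t) * (α * ∫ z, f (t - z) * expDensity z) =
      α * ∫ z, k (x - w j * t) * (expDensity z * f (t - z)) := by
    intro t
    rw [integral_const_mul]
    simp_rw [mul_comm (expDensity _)]
    ring
  simp_rw [h3]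
  rw [integral_const_mul, integral_integral_swap, sumDensityExp]
  · congr 2; ext z
    rw [h1, ← integral_add_right_eq_self _ z, ← integral_mul_const]
    congr 1; ext t
    have e1 : x - w j * (t + z) = x - w j * z - w j * t := by ring
    have e2 : t + z - z = t := by ring
    rw [e1, e2]; ring
  · exact hk.integrable_mul (T := fun p : ℝ × ℝ => x - w j * p.1) (by fun_prop)
      (integrable_expDensity.convolution_integrand (ContinuousLinearMap.mul ℝ ℝ) hfi)

/-- The derivative of the distribution function when weight is transferred from `j` to `i` with
relative speed `m`. -/
theorem hasDerivAt_weightedSumCDF_transfer (hX : IsGammaFamily P α X) {w : Fin n → ℝ}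
    {i j : Fin n} (hij : i ≠ j) (hw : ∀ l, 0 < w l) (m x : ℝ) :
    HasDerivAt (fun t => weightedSumCDF P X (transfer w i j t (t * m)) x)
      (α / w i * (m * sumDensityExp P α X w i (w j) x - sumDensityExp P α X w i (w i) x)) 0 := by
  set S := partialSum X w (Finset.univ.erase i) with hSdef
  have hS : Measurable S := hX.measurable_partialSum w _
  have hXj := hX.measurable j
  have hSi : Integrable S P := hX.integrable_partialSum w _
  have hne : ∀ᵐ ω ∂P, x - S ω ≠ 0 := by
    filter_upwards [hX.ae_partialSum_ne (s := Finset.univ.erase i)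
      (Finset.mem_erase.2 ⟨hij.symm, Finset.mem_univ j⟩) (hw j) x] with ω hω h
    exact hω (by linarith)
  have h := hX.hasDerivAt_integral_gammaCDF (c := fun ω => x - S ω) (d := fun ω => m * X j ω)
    (hw i) (by fun_prop) (by fun_prop) ((integrable_const x).sub hSi)
    ((hX.integrable j).const_mul m) hne
  have hpf := isPolyaKernel_gammaPDFReal hX.one_le
  have e : ∫ ω, gammaPDFReal α 1 ((x - S ω) / w i) * ((m * X j ω - (x - S ω) / w i) / w i) ∂P =
      α / w i * (m * sumDensityExp P α X w i (w j) x - sumDensityExp P α X w i (w i) x) := by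
    have i1 : Integrable (fun ω => gammaPDFReal α 1 ((x - S ω) / w i) * X j ω) P :=
      hpf.integrable_mul (by fun_prop) (hX.integrable j)
    have i2 : Integrable (fun ω => gammaPDFReal α 1 ((x - S ω) / w i) * ((x - S ω) / w i)) P :=
      hpf.integrable_mul (by fun_prop) (((integrable_const x).sub hSi).div_const _)
    have e1 : (fun ω => gammaPDFReal α 1 ((x - S ω) / w i) *
        ((m * X j ω - (x - S ω) / w i) / w i)) = fun ω =>
        m / w i * (gammaPDFReal α 1 ((x - S ω) / w i) * X j ω) -
        1 / w i * (gammaPDFReal α 1 ((x - S ω) / w i) * ((x - S ω) / w i)) := by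
      ext ω; ring
    rw [e1, integral_sub (i1.const_mul _) (i2.const_mul _), integral_const_mul,
      integral_const_mul, hX.integral_gammaPDFReal_mul_other hij hw,
      hX.integral_gammaPDFReal_mul_self (hw i)]
    ring
  rw [e] at h
  refine h.congr_of_eventuallyEq ?_
  filter_upwards [Ioi_mem_nhds (show -(w i) < 0 by linarith [hw i])] with t ht
  have hti : transfer w i j t (t * m) i = w i + t := by
    simp [transfer, hij]
  rw [hX.weightedSumCDF_eq (i := i) (by rw [hti]; linarith [mem_Ioi.1 ht]), hti]
  congr 1; ext ω
  rw [partialSum_transfer hij]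
  congr 2; ring

end IsGammaFamily

/-! ### Exchanging weight between two coordinates -/

theorem eventually_lt_of_hasDerivAt_pos {g : ℝ → ℝ} {g' : ℝ} (hg : HasDerivAt g g' 0)
    (h : 0 < g') : ∀ᶠ t in 𝓝[>] (0 : ℝ), g 0 < g t := by
  have h1 := (hasDerivAt_iff_tendsto_slope.1 hg).eventually (lt_mem_nhds h)
  filter_upwards [h1.filter_mono (nhdsWithin_mono _ fun t ht => (ne_of_gt ht)),
    self_mem_nhdsWithin] with t ht ht0
  rw [slope_def_field, sub_zero] at ht
  have := (div_pos_iff_of_pos_right (mem_Ioi.1 ht0)).1 ht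
  linarith

namespace IsGammaFamily

variable {Ω : Type*} [MeasurableSpace Ω] {P : Measure Ω} [IsProbabilityMeasure P] {n : ℕ}
  {α : ℝ} {X : Fin n → Ω → ℝ}

theorem strictAntiOn_weightedSumCDF_update (hX : IsGammaFamily P α X) {w : Fin n → ℝ}
    {i j : Fin n} (hij : i ≠ j) (hw : ∀ l, 0 < w l) {x : ℝ} (hx : 0 < x) :
    StrictAntiOn (fun t => weightedSumCDF P X (Function.update w i t) x) (Ioi 0) := by
  have hd : ∀ t ∈ Ioi (0 : ℝ), ∃ D < 0,
      HasDerivAt (fun t => weightedSumCDF P X (Function.update w i t) x) D t := by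
    intro t ht
    have hw' : ∀ l, 0 < Function.update w i t l := by
      intro l
      rcases eq_or_ne l i with rfl | h
      · simpa using ht
      · simpa [h] using hw l
    obtain ⟨D, hD, h⟩ : ∃ D < 0, HasDerivAt (fun u => weightedSumCDF P X
        (transfer (Function.update w i t) i j u (u * 0)) x) D 0 := by
      refine ⟨_, ?_, hX.hasDerivAt_weightedSumCDF_transfer hij hw' 0 x⟩
      have hp := hX.sumDensityExp_pos hw' i (hw' i) hx
      have : 0 < α / Function.update w i t i := div_pos hX.pos (hw' i)
      rw [zero_mul, zero_sub]
      exact mul_neg_of_pos_of_neg this (neg_neg_of_pos hp)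
    have h1 : HasDerivAt (fun u => weightedSumCDF P X
        (transfer (Function.update w i t) i j u (u * 0)) x) D (t - t) := by
      rwa [sub_self]
    have h2 := h1.comp_sub_const t t
    have e : ∀ u, transfer (Function.update w i t) i j (u - t) ((u - t) * 0) =
        Function.update w i u := by
      intro u
      ext l
      rcases eq_or_ne l j with rfl | hlj
      · simp [transfer, hij.symm]
      · rcases eq_or_ne l i with rfl | hli
        · simp [transfer, hlj]
        · simp [transfer, hlj, hli]
    simp only [e] at h2
    exact ⟨D, hD, h2⟩
  refine strictAntiOn_of_deriv_neg (convex_Ioi 0) (fun t ht => ?_) fun t ht => ?_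
  · obtain ⟨D, -, hD⟩ := hd t ht
    exact hD.continuousAt.continuousWithinAt
  · rw [interior_Ioi] at ht
    obtain ⟨D, hD0, hD⟩ := hd t ht
    rw [hD.deriv]
    exact hD0

theorem weightedSumCDF_strictAnti (hX : IsGammaFamily P α X) {w w' : Fin n → ℝ}
    (hn : 2 ≤ n) (hw : ∀ l, 0 < w l) (hww' : w ≤ w') (hne : w ≠ w') {x : ℝ} (hx : 0 < x) :
    weightedSumCDF P X w' x < weightedSumCDF P X w x := by
  obtain ⟨i, hi⟩ := Function.ne_iff.1 hne
  have hlt : w i < w' i := lt_of_le_of_ne (hww' i) hi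
  have : Nontrivial (Fin n) := Fin.nontrivial_iff_two_le.2 hn
  obtain ⟨j, hj⟩ := exists_ne i
  have h1 := hX.strictAntiOn_weightedSumCDF_update hj.symm hw hx (hw i) ((hw i).trans hlt) hlt
  simp only [Function.update_eq_self] at h1
  refine (hX.weightedSumCDF_anti (fun l => ?_) x).trans_lt h1
  rcases eq_or_ne l i with rfl | h
  · simp
  · simpa [h] using hww' l

/-- If `w i < w j`, some small transfer of weight from `j` to `i` keeps the distribution function
fixed at `x` and increases it at every prescribed `y > x`. -/
theorem exists_transfer (hX : IsGammaFamily P α X) {w : Fin n → ℝ} {i j : Fin n}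
    (hw : ∀ l, 0 < w l) (hij : w i < w j) {x y : ℝ} (hx : 0 < x) (hxy : x < y) {δ : ℝ}
    (hδ : 0 < δ) : ∃ ε ρ, 0 < ε ∧ ε < δ ∧ 0 < ρ ∧ ρ < δ ∧
      weightedSumCDF P X (transfer w i j ε ρ) x = weightedSumCDF P X w x ∧
      weightedSumCDF P X w y < weightedSumCDF P X (transfer w i j ε ρ) y := by
  have hne : i ≠ j := fun h => by rw [h] at hij; exact hij.false
  have hy : 0 < y := hx.trans hxy
  set Nix := sumDensityExp P α X w i (w i) x with hNix
  set Njx := sumDensityExp P α X w i (w j) x with hNjx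
  set Niy := sumDensityExp P α X w i (w i) y with hNiy
  set Njy := sumDensityExp P α X w i (w j) y with hNjy
  have pix : 0 < Nix := hX.sumDensityExp_pos hw i (hw i) hx
  have pjx : 0 < Njx := hX.sumDensityExp_pos hw i (hw j) hx
  have piy : 0 < Niy := hX.sumDensityExp_pos hw i (hw i) hy
  have pjy : 0 < Njy := hX.sumDensityExp_pos hw i (hw j) hy
  have hratio : Njx * Niy < Nix * Njy :=
    (hX.isPolyaKernel_sumDensity hw i).exponential_ratio_lt (hw i) hij hx hxy
  -- `Nix / Njx` and `Niy / Njy` are the speeds which are stationary at `x` and at `y`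
  obtain ⟨m₁, hm₁y, hm₁x⟩ : ∃ m, Niy / Njy < m ∧ m < Nix / Njx :=
    exists_between ((div_lt_div_iff₀ pjy pjx).2 (by linarith))
  have hm₁ : 0 < m₁ := (div_pos piy pjy).trans hm₁y
  obtain ⟨m₂, hm₂⟩ : ∃ m, Nix / Njx < m := exists_gt _
  rw [div_lt_iff₀ pjy] at hm₁y
  rw [lt_div_iff₀ pjx] at hm₁x
  have hm₁₂ : m₁ < m₂ := by
    rw [div_lt_iff₀ pjx] at hm₂
    exact lt_of_mul_lt_mul_right (hm₁x.trans hm₂) pjx.le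
  rw [div_lt_iff₀ pjx] at hm₂
  have hc : 0 < α / w i := div_pos hX.pos (hw i)
  have h0 : ∀ m : ℝ, transfer w i j 0 (0 * m) = w := by
    intro m; simp [transfer]
  have ev1 := eventually_lt_of_hasDerivAt_pos
    (hX.hasDerivAt_weightedSumCDF_transfer hne hw m₁ x).neg
    (by rw [neg_pos]; exact mul_neg_of_pos_of_neg hc (by linarith))
  have ev2 := eventually_lt_of_hasDerivAt_pos
    (hX.hasDerivAt_weightedSumCDF_transfer hne hw m₂ x) (mul_pos hc (by linarith))
  have ev3 := eventually_lt_of_hasDerivAt_pos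
    (hX.hasDerivAt_weightedSumCDF_transfer hne hw m₁ y) (mul_pos hc (by linarith))
  have ev4 : ∀ᶠ t in 𝓝[>] (0 : ℝ), t < δ := nhdsWithin_le_nhds (Iio_mem_nhds hδ)
  have ev5 : ∀ᶠ t in 𝓝[>] (0 : ℝ), t * m₂ < δ := by
    have : Tendsto (fun t : ℝ => t * m₂) (𝓝[>] 0) (𝓝 (0 * m₂)) :=
      ((continuous_id.mul continuous_const).tendsto 0).mono_left nhdsWithin_le_nhds
    rw [zero_mul] at this
    exact this.eventually (gt_mem_nhds hδ)
  have ev6 : ∀ᶠ t in 𝓝[>] (0 : ℝ), t ∈ Ioi (0 : ℝ) := self_mem_nhdsWithin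
  obtain ⟨t, h1, h2, h3, h4, h5, h6⟩ :=
    (ev1.and (ev2.and (ev3.and (ev4.and (ev5.and ev6))))).exists
  simp only [Pi.neg_apply, h0] at h1 h2 h3
  have ht : 0 < t := h6
  have hti : ∀ m, transfer w i j t (t * m) i = w i + t := by
    intro m; simp [transfer, hne]
  have hcont : ContinuousOn (fun m => weightedSumCDF P X (transfer w i j t (t * m)) x)
      (Icc m₁ m₂) := by
    refine (hX.continuousOn_weightedSumCDF i).comp
      (f := fun m => (x, transfer w i j t (t * m))) ?_ fun m _ => ?_
    · refine (continuous_const.prodMk (continuous_const.update j ?_)).continuousOn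
      fun_prop
    · change 0 < transfer w i j t (t * m) i
      rw [hti]
      linarith [hw i]
  obtain ⟨m, ⟨hmm₁, hmm₂⟩, hm⟩ := intermediate_value_Icc hm₁₂.le hcont
    (show weightedSumCDF P X w x ∈ Icc _ _ from ⟨by linarith, h2.le⟩)
  have htm : t * m₁ ≤ t * m := mul_le_mul_of_nonneg_left hmm₁ ht.le
  refine ⟨t, t * m, ht, h4, (mul_pos ht hm₁).trans_le htm,
    (mul_le_mul_of_nonneg_left hmm₂ ht.le).trans_lt h5, hm, h3.trans_le ?_⟩
  refine hX.weightedSumCDF_anti (fun l => ?_) y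
  rcases eq_or_ne l j with rfl | hlj
  · simp only [transfer, Function.update_self]; linarith
  · simp [transfer, hlj]

/-- Two weighted sums whose distribution functions agree at `x` are strictly ordered beyond `x`.
Among all weight vectors between `θ` and `η` whose distribution function has the given value at
`x`, the maximizer of the distribution function at `y` admits no improving transfer, hence is
`η`. -/
theorem weightedSumCDF_lt_of_eq (hX : IsGammaFamily P α X) {θ η : Fin n → ℝ}
    (hθ : ∀ l, 0 < θ l) (hη : ∀ l, 0 < η l) (hmono : Monotone η) {k : Fin n} (hn : 2 ≤ n)
    (hlow : ∀ i, i < k → θ i < η i) (hhigh : ∀ i, k ≤ i → η i < θ i) {x y : ℝ} (hx : 0 < x)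
    (hxy : x < y) (heq : weightedSumCDF P X θ x = weightedSumCDF P X η x) :
    weightedSumCDF P X θ y < weightedSumCDF P X η y := by
  set K : Set (Fin n → ℝ) := Icc (θ ⊓ η) (θ ⊔ η) with hK
  have hKpos : ∀ w ∈ K, ∀ l, 0 < w l := fun w hw l =>
    (lt_min (hθ l) (hη l)).trans_le (hw.1 l)
  have hcont : ∀ z, ContinuousOn (fun w => weightedSumCDF P X w z) K := fun z =>
    (hX.continuousOn_weightedSumCDF k).comp (f := fun w => (z, w))
      (by fun_prop) fun w hw => hKpos w hw k
  set S : Set (Fin n → ℝ) := K ∩ (fun w => weightedSumCDF P X w x) ⁻¹' {weightedSumCDF P X η x}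
    with hS
  have hScomp : IsCompact S := isCompact_Icc.of_isClosed_subset
    ((hcont x).preimage_isClosed_of_isClosed isClosed_Icc isClosed_singleton) inter_subset_left
  have hθS : θ ∈ S := ⟨⟨inf_le_left, le_sup_left⟩, heq⟩
  have hmax : ∀ w ∈ S, (∀ v ∈ S, weightedSumCDF P X v y ≤ weightedSumCDF P X w y) → w = η := by
    rintro w ⟨hwK, hwx⟩ hwmax
    have hwpos := hKpos w hwK
    have hwx' : weightedSumCDF P X w x = weightedSumCDF P X η x := hwx
    by_contra hne
    have hupper : ∀ l, l < k → w l ≤ η l := fun l hl =>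
      (hwK.2 l).trans (max_le (hlow l hl).le le_rfl)
    have hlower : ∀ l, k ≤ l → η l ≤ w l := fun l hl =>
      (le_min (hhigh l hl).le le_rfl).trans (hwK.1 l)
    obtain ⟨i, hik, hi⟩ : ∃ i, i < k ∧ w i < η i := by
      by_contra! hc
      have hle : η ≤ w := fun l => (lt_or_ge l k).elim (hc l) (hlower l)
      exact (hX.weightedSumCDF_strictAnti hn hη hle (Ne.symm hne) hx).ne hwx'
    obtain ⟨j, hjk, hj⟩ : ∃ j, k ≤ j ∧ η j < w j := by
      by_contra! hc
      have hle : w ≤ η := fun l => (lt_or_ge l k).elim (hupper l) (hc l)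
      exact (hX.weightedSumCDF_strictAnti hn hwpos hle hne hx).ne' hwx'
    have hij : w i < w j := hi.trans_le ((hmono (hik.le.trans hjk)).trans hj.le)
    obtain ⟨ε, ρ, hε, hεδ, hρ, hρδ, hex, hey⟩ := hX.exists_transfer hwpos hij hx hxy
      (δ := min (η i - w i) (w j - η j)) (lt_min (sub_pos.2 hi) (sub_pos.2 hj))
    have hijne : i ≠ j := (hik.trans_le hjk).ne
    have hεi := hεδ.trans_le (min_le_left _ _)
    have hρj := hρδ.trans_le (min_le_right _ _)
    have hmem : transfer w i j ε ρ ∈ K := by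
      constructor
      · intro l
        rcases eq_or_ne l j with rfl | hlj
        · simp only [transfer, Function.update_self, Pi.inf_apply]
          exact (min_le_right _ _).trans (by linarith)
        · rcases eq_or_ne l i with rfl | hli
          · simp only [transfer, Function.update_of_ne hlj, Function.update_self]
            exact (hwK.1 l).trans (by linarith)
          · simpa only [transfer, Function.update_of_ne hlj, Function.update_of_ne hli]
              using hwK.1 l
      · intro l
        rcases eq_or_ne l j with rfl | hlj
        · simp only [transfer, Function.update_self]
          exact le_trans (by linarith) (hwK.2 l)
        · rcases eq_or_ne l i with rfl | hli
          · simp only [transfer, Function.update_of_ne hlj, Function.update_self, Pi.sup_apply]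
            exact le_trans (by linarith) (le_max_right _ _)
          · simpa only [transfer, Function.update_of_ne hlj, Function.update_of_ne hli]
              using hwK.2 l
    exact (hwmax _ ⟨hmem, hex.trans hwx'⟩).not_gt hey
  obtain ⟨w, hwS, hw⟩ := hScomp.exists_isMaxOn ⟨θ, hθS⟩ ((hcont y).mono inter_subset_left)
  obtain rfl := hmax w hwS fun v hv => hw hv
  refine lt_of_not_ge fun hge => ?_
  have := hmax θ hθS fun v hv => (hw hv).trans hge
  exact (hhigh k le_rfl).ne' (congrFun this k)

end IsGammaFamily

/-! ### Comparison near zero and near infinity -/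

theorem isPolyaKernel_indicator_Ici : IsPolyaKernel (indicator (Ici 0) fun _ => (1 : ℝ)) where
  measurable := measurable_const.indicator measurableSet_Ici
  bounded := ⟨1, fun x => indicator_le_self' (fun _ _ => zero_le_one) x⟩
  nonneg x := indicator_nonneg (fun _ _ => zero_le_one) x
  eq_zero x hx := indicator_of_notMem (not_le.2 hx) _
  pos x hx := by rw [indicator_of_mem (mem_Ici.2 hx.le)]; exact one_pos
  mul_le u p q hp hq := by
    by_cases hu : 0 ≤ u
    · rw [indicator_of_mem (mem_Ici.2 hu), indicator_of_mem (mem_Ici.2 (by positivity)),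
        indicator_of_mem (mem_Ici.2 (by positivity)), indicator_of_mem (mem_Ici.2 (by positivity))]
    · rw [indicator_of_notMem (show u ∉ Ici 0 from hu), zero_mul]
      exact mul_nonneg (indicator_nonneg (fun _ _ => zero_le_one) _)
        (indicator_nonneg (fun _ _ => zero_le_one) _)

/-- On `[0, v]` the density of `b * X` is at most `(a / b) ^ α * exp (v / a)` times the density
of `a * X`, when `X` is a gamma variable. -/
theorem integral_kernel_scale_le {α : ℝ} (hα : 1 ≤ α) {κ : ℝ → ℝ} (hκ : IsPolyaKernel κ)
    {a b u v : ℝ} (ha : 0 < a) (hb : 0 < b) (huv : u ≤ v) :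
    ∫ t, κ (u - b * t) * gammaPDFReal α 1 t ≤
      (a / b) ^ α * Real.exp (v / a) * ∫ t, κ (u - a * t) * gammaPDFReal α 1 t := by
  have hα0 : 0 < α := by linarith
  have hfi := integrable_gammaPDFReal hα0
  have scale : ∀ c : ℝ, 0 < c → ∫ t, κ (u - c * t) * gammaPDFReal α 1 t =
      ∫ t, κ (u - t) * (c⁻¹ * gammaPDFReal α 1 (t / c)) := by
    intro c hc
    have := Measure.integral_comp_mul_left (fun t => κ (u - t) * gammaPDFReal α 1 (t / c)) c
    simp only [mul_div_cancel_left₀ _ hc.ne', smul_eq_mul, abs_of_pos (inv_pos.2 hc)] at this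
    rw [this, ← integral_const_mul]
    congr 1; ext t; ring
  have hint : ∀ c : ℝ, 0 < c →
      Integrable fun t => κ (u - t) * (c⁻¹ * gammaPDFReal α 1 (t / c)) := fun c hc =>
    hκ.integrable_mul (by fun_prop) ((hfi.comp_div hc.ne').const_mul _)
  rw [scale b hb, scale a ha, ← integral_const_mul]
  refine integral_mono (hint b hb) ((hint a ha).const_mul _) fun t => ?_
  have hΓ : 0 < Real.Gamma α := Real.Gamma_pos_of_pos hα0
  rcases lt_or_ge u t with ht | ht
  · simp [hκ.eq_zero (u - t) (by linarith)]
  rcases lt_or_ge t 0 with ht0 | ht0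
  · simp [gammaPDFReal_of_neg (div_neg_of_neg_of_pos ht0 hb),
      gammaPDFReal_of_neg (div_neg_of_neg_of_pos ht0 ha)]
  have key : b⁻¹ * gammaPDFReal α 1 (t / b) ≤
      (a / b) ^ α * Real.exp (v / a) * (a⁻¹ * gammaPDFReal α 1 (t / a)) := by
    rw [gammaPDFReal_one_eq (div_nonneg ht0 hb.le), gammaPDFReal_one_eq (div_nonneg ht0 ha.le),
      Real.div_rpow ht0 hb.le, Real.div_rpow ht0 ha.le, Real.div_rpow ha.le hb.le]
    have pw : ∀ c : ℝ, 0 < c → c ^ α = c * c ^ (α - 1) := fun c hc => by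
      rw [← Real.rpow_one_add' hc.le (by linarith)]; congr 1; ring
    have hpa : 0 < a ^ (α - 1) := Real.rpow_pos_of_pos ha _
    have hpb : 0 < b ^ (α - 1) := Real.rpow_pos_of_pos hb _
    have hpt : 0 ≤ t ^ (α - 1) := Real.rpow_nonneg ht0 _
    rw [pw a ha, pw b hb]
    have hexp : Real.exp (-(t / b)) ≤ Real.exp (v / a) * Real.exp (-(t / a)) := by
      rw [← Real.exp_add]
      refine Real.exp_le_exp.2 ?_
      have h1 : t / a ≤ v / a := by gcongr; linarith
      have h2 : 0 ≤ t / b := by positivity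
      linarith
    calc b⁻¹ * ((Real.Gamma α)⁻¹ * (t ^ (α - 1) / b ^ (α - 1) * Real.exp (-(t / b))))
        = (b⁻¹ * ((Real.Gamma α)⁻¹ * (t ^ (α - 1) / b ^ (α - 1)))) * Real.exp (-(t / b)) := by
          ring
      _ ≤ (b⁻¹ * ((Real.Gamma α)⁻¹ * (t ^ (α - 1) / b ^ (α - 1)))) *
          (Real.exp (v / a) * Real.exp (-(t / a))) := by gcongr
      _ = _ := by field_simp
  calc κ (u - t) * (b⁻¹ * gammaPDFReal α 1 (t / b))
      ≤ κ (u - t) * ((a / b) ^ α * Real.exp (v / a) * (a⁻¹ * gammaPDFReal α 1 (t / a))) :=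
        mul_le_mul_of_nonneg_left key (hκ.nonneg _)
    _ = _ := by ring

theorem integrable_exp_mul_gammaPDFReal {α r : ℝ} (hα : 0 < α) (hr : r < 1) :
    Integrable fun t => Real.exp (r * t) * gammaPDFReal α 1 t := by
  have hr' : 0 < 1 - r := by linarith
  have hg : Integrable (gammaPDFReal α (1 - r)) := by
    refine ⟨(measurable_gammaPDFReal α _).aestronglyMeasurable, ?_⟩
    rw [hasFiniteIntegral_iff_ofReal (ae_of_all _ (gammaPDFReal_nonneg hα hr'))]
    change ∫⁻ x, gammaPDF α (1 - r) x < ⊤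
    rw [lintegral_gammaPDF_eq_one hα hr']
    exact ENNReal.one_lt_top
  refine (hg.const_mul ((1 - r) ^ α)⁻¹).congr (ae_of_all _ fun t => ?_)
  rcases lt_or_ge t 0 with ht | ht
  · simp [gammaPDFReal_of_neg ht]
  · have hp : (1 - r) ^ α ≠ 0 := (Real.rpow_pos_of_pos hr' α).ne'
    have e : Real.exp (-((1 - r) * t)) = Real.exp (r * t) * Real.exp (-t) := by
      rw [← Real.exp_add]; congr 1; ring
    simp only
    rw [gammaPDFReal_one_eq ht, gammaPDFReal, if_pos ht, e]
    field_simp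

theorem le_gammaMeasure_Ioi {α u : ℝ} (hα : 1 ≤ α) (hu : 1 ≤ u) :
    (Real.Gamma α)⁻¹ * Real.exp (-u) ≤ (gammaMeasure α 1).real (Ioi u) := by
  have hα0 : 0 < α := by linarith
  rw [← integral_indicator_one measurableSet_Ioi, integral_gammaMeasure hα0]
  have e : (fun t => indicator (Ioi u) 1 t * gammaPDFReal α 1 t) =
      indicator (Ioi u) (gammaPDFReal α 1) := by
    ext t
    by_cases ht : t ∈ Ioi u <;> simp [ht]
  rw [e, integral_indicator measurableSet_Ioi, ← integral_exp_neg_Ioi, ← integral_const_mul]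
  refine setIntegral_mono_on ((integrableOn_exp_neg_Ioi u).const_mul _)
    (integrable_gammaPDFReal hα0).integrableOn measurableSet_Ioi fun t ht => ?_
  have ht1 : 1 ≤ t := hu.trans (le_of_lt ht)
  have hΓ : 0 < Real.Gamma α := Real.Gamma_pos_of_pos hα0
  rw [gammaPDFReal_one_eq (by linarith)]
  have : 1 ≤ t ^ (α - 1) := Real.one_le_rpow ht1 (by linarith)
  refine mul_le_mul_of_nonneg_left ?_ (by positivity)
  exact le_mul_of_one_le_left (Real.exp_pos _).le this

namespace IsGammaFamily

variable {Ω : Type*} [MeasurableSpace Ω] {P : Measure Ω} [IsProbabilityMeasure P] {n : ℕ}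
  {α : ℝ} {X : Fin n → Ω → ℝ}

theorem weightedSumCDF_eq_integral_indicator (hX : IsGammaFamily P α X) (w : Fin n → ℝ) (x : ℝ) :
    weightedSumCDF P X w x =
      ∫ ω, indicator (Ici 0) (fun _ => (1 : ℝ)) (x - partialSum X w Finset.univ ω) ∂P := by
  rw [hX.weightedSumCDF_eq_measureReal, ← integral_indicator_one
    (measurableSet_le (hX.measurable_partialSum w _) measurable_const)]
  congr 1; ext ω
  simp [indicator]

/-- The comparison of `integral_kernel_scale_le`, one coordinate at a time. For the indicator of
`[0, ∞)` it compares the two distribution functions on `(-∞, v]`. -/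
theorem integral_kernel_le (hX : IsGammaFamily P α X) {θ η : Fin n → ℝ} (hθ : ∀ l, 0 < θ l)
    (hη : ∀ l, 0 < η l) (s : Finset (Fin n)) {κ : ℝ → ℝ} (hκ : IsPolyaKernel κ) {u v : ℝ}
    (huv : u ≤ v) :
    ∫ ω, κ (u - partialSum X η s ω) ∂P ≤
      (∏ l ∈ s, (θ l / η l) ^ α * Real.exp (v / θ l)) *
        ∫ ω, κ (u - partialSum X θ s ω) ∂P := by
  induction s using Finset.induction_on generalizing κ u with
  | empty => simp [partialSum]
  | insert i s hi ih =>
    have hconv : ∀ c : ℝ, 0 < c →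
        IsPolyaKernel fun x => ∫ t, κ (x - c * t) * gammaPDFReal α 1 t := fun c hc =>
      hκ.convolution (isPolyaKernel_gammaPDFReal hX.one_le) (integrable_gammaPDFReal hX.pos) hc
    rw [hX.integral_partialSum_insert η hi hκ, hX.integral_partialSum_insert θ hi hκ,
      Finset.prod_insert hi, mul_assoc]
    have hSη := hX.measurable_partialSum η s
    have hc : 0 ≤ (θ i / η i) ^ α * Real.exp (v / θ i) := by
      have := div_pos (hθ i) (hη i)
      positivity
    refine le_trans ?_ (mul_le_mul_of_nonneg_left (ih (hconv _ (hθ i)) huv) hc)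
    rw [← integral_const_mul]
    refine integral_mono_ae ((hconv _ (hη i)).integrable_comp (by fun_prop))
      (((hconv _ (hθ i)).integrable_comp (by fun_prop)).const_mul _) ?_
    filter_upwards [hX.ae_nonneg] with ω hω
    have hS0 : 0 ≤ partialSum X η s ω :=
      Finset.sum_nonneg fun l _ => mul_nonneg (hη l).le (hω l)
    exact integral_kernel_scale_le hX.one_le hκ (hθ i) (hη i) (by linarith)

/-- Near the origin the weight vector with the larger product has the smaller distribution
function. -/
theorem exists_weightedSumCDF_lt_of_prod_lt (hX : IsGammaFamily P α X) {θ η : Fin n → ℝ}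
    (hθ : ∀ l, 0 < θ l) (hη : ∀ l, 0 < η l) (hprod : ∏ l, θ l < ∏ l, η l) :
    ∃ x, 0 < x ∧ weightedSumCDF P X η x < weightedSumCDF P X θ x := by
  have hlim : Tendsto (fun v : ℝ => ∏ l, (θ l / η l) ^ α * Real.exp (v / θ l)) (𝓝[>] 0)
      (𝓝 (∏ l, (θ l / η l) ^ α * Real.exp (0 / θ l))) := by
    have : Continuous fun v : ℝ => ∏ l, (θ l / η l) ^ α * Real.exp (v / θ l) := by fun_prop
    exact (this.tendsto 0).mono_left nhdsWithin_le_nhds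
  have hlt : ∏ l, (θ l / η l) ^ α * Real.exp (0 / θ l) < 1 := by
    simp only [zero_div, Real.exp_zero, mul_one]
    rw [Real.finsetProd_rpow _ _ fun l _ => (div_pos (hθ l) (hη l)).le, Finset.prod_div_distrib]
    have hpη : 0 < ∏ l, η l := Finset.prod_pos fun l _ => hη l
    have hpθ : 0 < ∏ l, θ l := Finset.prod_pos fun l _ => hθ l
    exact Real.rpow_lt_one (by positivity) ((div_lt_one hpη).2 hprod) hX.pos
  obtain ⟨x, hx1, hx0⟩ := ((hlim.eventually (gt_mem_nhds hlt)).and self_mem_nhdsWithin).exists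
  refine ⟨x, hx0, ?_⟩
  rw [hX.weightedSumCDF_eq_integral_indicator, hX.weightedSumCDF_eq_integral_indicator]
  refine (hX.integral_kernel_le hθ hη _ isPolyaKernel_indicator_Ici le_rfl).trans_lt ?_
  exact mul_lt_of_lt_one_left ((hX.isPolyaKernel_average (fun l _ => hθ l)
    isPolyaKernel_indicator_Ici).pos x hx0) hx1

theorem integrable_exp_partialSum (hX : IsGammaFamily P α X) {w : Fin n → ℝ} {r : ℝ}
    (hr : ∀ l, r * w l < 1) :
    Integrable (fun ω => Real.exp (r * partialSum X w Finset.univ ω)) P := by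
  have h := (hX.indep.comp (fun l t => w l * t)
    (fun l => measurable_id.const_mul _)).integrable_exp_mul_sum (t := r) (s := Finset.univ)
    (fun l => (measurable_id.const_mul _).comp (hX.measurable l)) fun l _ => by
      have h1 : Integrable (fun t => Real.exp (r * w l * t)) (P.map (X l)) := by
        rw [hX.map_eq]
        exact integrable_gammaMeasure hX.pos (integrable_exp_mul_gammaPDFReal hX.pos (hr l))
      refine (h1.comp_measurable (hX.measurable l)).congr (ae_of_all _ fun ω => ?_)
      simp [mul_assoc]
  refine h.congr (ae_of_all _ fun ω => ?_)
  simp [partialSum]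

/-- Near infinity the tail is governed by the largest weight. -/
theorem exists_weightedSumCDF_lt_of_forall_lt (hX : IsGammaFamily P α X) {θ η : Fin n → ℝ}
    (hθ : ∀ l, 0 < θ l) (hη : ∀ l, 0 < η l) {j : Fin n} (hj : ∀ l, η l ≤ η j)
    (hjlt : η j < θ j) :
    ∃ x, 0 < x ∧ weightedSumCDF P X θ x < weightedSumCDF P X η x := by
  obtain ⟨c, hc1, hc2⟩ := exists_between hjlt
  have hc : 0 < c := (hη j).trans hc1
  have hα := hX.one_le
  have hΓ : 0 < Real.Gamma α := Real.Gamma_pos_of_pos hX.pos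
  have hSη := hX.measurable_partialSum η Finset.univ
  have hint : Integrable (fun ω => Real.exp (c⁻¹ * partialSum X η Finset.univ ω)) P :=
    hX.integrable_exp_partialSum fun l => by
      rw [inv_mul_lt_iff₀ hc, mul_one]
      exact (hj l).trans_lt hc1
  set M := mgf (partialSum X η Finset.univ) P c⁻¹ with hM
  -- the Chernoff bound for `η` decays faster than the tail of the single summand `θ j * X j`
  have hrate : 0 < c⁻¹ - (θ j)⁻¹ := sub_pos.2 ((inv_lt_inv₀ (hθ j) hc).2 hc2)
  have hlim : Tendsto (fun x : ℝ => Real.exp ((c⁻¹ - (θ j)⁻¹) * x)) atTop atTop :=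
    Real.tendsto_exp_atTop.comp (tendsto_id.const_mul_atTop hrate)
  obtain ⟨x, hx1, hx2⟩ := ((hlim.eventually_gt_atTop (M * Real.Gamma α)).and
    (eventually_ge_atTop (θ j))).exists
  have hx0 : 0 < x := (hθ j).trans_le hx2
  refine ⟨x, hx0, ?_⟩
  have compl : ∀ w, weightedSumCDF P X w x =
      1 - P.real {ω | x < partialSum X w Finset.univ ω} := by
    intro w
    rw [hX.weightedSumCDF_eq_measureReal, ← probReal_compl_eq_one_sub
      (measurableSet_lt measurable_const (hX.measurable_partialSum w _))]
    congr 1; ext ω; simp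
  have upper : P.real {ω | x < partialSum X η Finset.univ ω} ≤ Real.exp (-c⁻¹ * x) * M :=
    (measureReal_mono (s₂ := {ω | x ≤ partialSum X η Finset.univ ω})
      fun ω (hω : x < partialSum X η Finset.univ ω) => hω.le).trans
      (measure_ge_le_exp_mul_mgf x (inv_pos.2 hc).le hint)
  have lower : (Real.Gamma α)⁻¹ * Real.exp (-(x / θ j)) ≤
      P.real {ω | x < partialSum X θ Finset.univ ω} := by
    refine (le_gammaMeasure_Ioi hα ((one_le_div (hθ j)).2 hx2)).trans ?_
    rw [← hX.map_eq j, map_measureReal_apply (hX.measurable j) measurableSet_Ioi]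
    refine ENNReal.toReal_mono (measure_ne_top _ _) (measure_mono_ae ?_)
    filter_upwards [hX.ae_nonneg] with ω hω h
    have h1 : x < θ j * X j ω := by
      have := (div_lt_iff₀ (hθ j)).1 (show x / θ j < X j ω from h)
      linarith
    exact h1.trans_le (Finset.single_le_sum (f := fun l => θ l * X l ω)
      (fun l _ => mul_nonneg (hθ l).le (hω l)) (Finset.mem_univ j))
  have hcmp : Real.exp (-c⁻¹ * x) * M < (Real.Gamma α)⁻¹ * Real.exp (-(x / θ j)) := by
    have e : Real.exp (-(x / θ j)) =
        Real.exp (-c⁻¹ * x) * Real.exp ((c⁻¹ - (θ j)⁻¹) * x) := by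
      rw [← Real.exp_add]; congr 1; ring
    rw [e, inv_mul_eq_div, lt_div_iff₀ hΓ, mul_assoc]
    exact mul_lt_mul_of_pos_left hx1 (Real.exp_pos _)
  rw [compl, compl]
  linarith

/-! ### The unique crossing -/

theorem exists_unique_crossing (hX : IsGammaFamily P α X) {θ η : Fin n → ℝ}
    (hθ : ∀ l, 0 < θ l) (hmono : Monotone η) {k : Fin n} (hk : 1 ≤ (k : ℕ))
    (hlow : ∀ i, i < k → θ i < η i) (hhigh : ∀ i, k ≤ i → η i < θ i)
    (hprod : ∏ l, θ l < ∏ l, η l) :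
    ∃ x₀ : ℝ, 0 < x₀ ∧
      (∀ x, 0 < x → x < x₀ → weightedSumCDF P X η x < weightedSumCDF P X θ x) ∧
      (∀ x, x₀ < x → weightedSumCDF P X θ x < weightedSumCDF P X η x) := by
  have hn : 2 ≤ n := by have := k.isLt; omega
  have hη : ∀ l, 0 < η l := fun l => by
    have h0 : (⟨0, by omega⟩ : Fin n) < k := Fin.lt_def.2 hk
    exact ((hθ _).trans (hlow _ h0)).trans_le (hmono (Fin.le_def.2 (Nat.zero_le _)))
  have hcross : ∀ x y, 0 < x → x < y → weightedSumCDF P X θ x = weightedSumCDF P X η x →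
      weightedSumCDF P X θ y < weightedSumCDF P X η y := fun x y hx hxy h =>
    hX.weightedSumCDF_lt_of_eq hθ hη hmono hn hlow hhigh hx hxy h
  have hcont : ∀ w : Fin n → ℝ, (∀ l, 0 < w l) → Continuous (weightedSumCDF P X w) :=
    fun w hw => continuousOn_univ.1 ((hX.continuousOn_weightedSumCDF k).comp
      (f := fun x => (x, w)) (by fun_prop) fun x _ => hw k)
  set D : ℝ → ℝ := fun x => weightedSumCDF P X η x - weightedSumCDF P X θ x with hD
  have hDc : Continuous D := (hcont η hη).sub (hcont θ hθ)
  have hDz : ∀ x y, 0 < x → x < y → D x = 0 → 0 < D y := fun x y hx hxy h =>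
    sub_pos.2 (hcross x y hx hxy (sub_eq_zero.1 h).symm)
  obtain ⟨a, ha0, ha⟩ := hX.exists_weightedSumCDF_lt_of_prod_lt hθ hη hprod
  have ha' : D a < 0 := sub_neg.2 ha
  have hlast : k ≤ (⟨n - 1, by omega⟩ : Fin n) := Fin.le_def.2 (by have := k.isLt; simp; omega)
  obtain ⟨b, hb0, hb⟩ := hX.exists_weightedSumCDF_lt_of_forall_lt hθ hη
    (fun l => hmono (Fin.le_def.2 (by have := l.isLt; simp; omega))) (hhigh _ hlast)
  have hb' : 0 < D b := sub_pos.2 hb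
  -- a sign change from `+` to `-` would contain a zero followed by a negative value
  have hab : a < b := by
    by_contra! hba
    obtain ⟨z, hz, hz0⟩ := intermediate_value_Icc' hba hDc.continuousOn
      (show (0 : ℝ) ∈ Icc _ _ from ⟨ha'.le, hb'.le⟩)
    rcases hz.2.eq_or_lt with rfl | hza
    · exact ha'.ne hz0
    · exact (hDz z a (hb0.trans_le hz.1) hza hz0).not_gt ha'
  obtain ⟨x₀, hx₀, hx₀z⟩ := intermediate_value_Icc hab.le hDc.continuousOn
    (show (0 : ℝ) ∈ Icc _ _ from ⟨ha'.le, hb'.le⟩)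
  have hx₀pos : 0 < x₀ := ha0.trans_le hx₀.1
  have hax₀ : a < x₀ := lt_of_le_of_ne hx₀.1 fun h => ha'.ne (h ▸ hx₀z)
  refine ⟨x₀, hx₀pos, fun x hx hxx₀ => ?_, fun x hx => sub_pos.1 (hDz x₀ x hx₀pos hx hx₀z)⟩
  refine sub_neg.1 (show D x < 0 from ?_)
  by_contra! hDx
  have hxa : ∃ z, 0 < z ∧ z < x₀ ∧ D z = 0 := by
    rcases le_total x a with h | h
    · obtain ⟨z, hz, hz0⟩ := intermediate_value_Icc' h hDc.continuousOn
        (show (0 : ℝ) ∈ Icc _ _ from ⟨ha'.le, hDx⟩)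
      exact ⟨z, hx.trans_le hz.1, hz.2.trans_lt hax₀, hz0⟩
    · obtain ⟨z, hz, hz0⟩ := intermediate_value_Icc h hDc.continuousOn
        (show (0 : ℝ) ∈ Icc _ _ from ⟨ha'.le, hDx⟩)
      exact ⟨z, ha0.trans_le hz.1, hz.2.trans_lt hxx₀, hz0⟩
  obtain ⟨z, hz, hzx, hz0⟩ := hxa
  exact (hDz z x₀ hz hzx hz0).ne' hx₀z

end IsGammaFamily

theorem theorem1 {Ω : Type*} [MeasurableSpace Ω] (P : Measure Ω) [IsProbabilityMeasure P]
    (n : ℕ) (α : ℝ) (hα : 1 ≤ α)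
    (X : Fin n → Ω → ℝ) (hlaw : ∀ i, HasLaw (X i) (gammaMeasure α 1) P) (hindep : iIndepFun X P)
    (θ η : Fin n → ℝ) (hθpos : ∀ i, 0 < θ i) (hθ : Monotone θ) (hη : Monotone η)
    (hcross : ∃ k : Fin n, 1 ≤ (k : ℕ) ∧ (∀ i, i < k → θ i < η i) ∧ (∀ i, k ≤ i → η i < θ i))
    (hprod : ∏ i, θ i < ∏ i, η i) :
    ∃ x₀ : ℝ, 0 < x₀ ∧
      (∀ x, 0 < x → x < x₀ → weightedSumCDF P X η x < weightedSumCDF P X θ x) ∧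
      (∀ x, x₀ < x → weightedSumCDF P X θ x < weightedSumCDF P X η x) := by
  -- pass to everywhere measurable versions of the variables
  set Y : Fin n → Ω → ℝ := fun i => (hlaw i).aemeasurable.mk (X i) with hY
  have hXY : ∀ i, X i =ᵐ[P] Y i := fun i => (hlaw i).aemeasurable.ae_eq_mk
  have hYfam : IsGammaFamily P α Y :=
    { one_le := hα
      measurable := fun i => (hlaw i).aemeasurable.measurable_mk
      map_eq := fun i => by rw [← Measure.map_congr (hXY i), (hlaw i).map_eq]
      indep := hindep.congr hXY }
  have hcdf : ∀ w x, weightedSumCDF P X w x = weightedSumCDF P Y w x := by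
    intro w x
    have h : (fun ω => ∑ i, w i * X i ω) =ᵐ[P] fun ω => ∑ i, w i * Y i ω := by
      filter_upwards [ae_all_iff.2 hXY] with ω hω
      simp only [hω]
    rw [weightedSumCDF, weightedSumCDF, Measure.map_congr h]
  obtain ⟨k, hk, hlow, hhigh⟩ := hcross
  simp only [hcdf]
  exact hYfam.exists_unique_crossing hθpos hη hk hlow hhigh hprod
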